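/- **Setting.** For $0\le k<1$ let $F(\varphi,k)=\int_0^\varphi (1-k^2\sin^2 s)^{-1/2}\,ds$, $K(k)=F(\pi/2,k)$, let $\operatorname{am}(\cdot,k)$ be the inverse of $F(\cdot,k)$, and $\operatorname{sn}=\sin\operatorname{am}$, $\operatorname{cn}=\cos\operatorname{am}$. For $\Omega>0$, $\zeta>0$ and $q_0>0$ with $\tfrac32\zeta\le q_0^2<1+\zeta$ put $$\omega=\sqrt{2q_0^2-\zeta},\qquad k^2=\frac{(1+\zeta-q_0^2)\,q_0^2}{2q_0^2-\zeta},\qquad q(\tau)=\frac{q_0\operatorname{cn}(\omega\tau,k)}{\sqrt{1+q_0^2\operatorname{sn}^2(\omega\tau,k)}},\qquad p(\tau)=\frac{q'(\tau)}{1+q(\tau)^2},$$ $$\alpha(t)=\sqrt{\tfrac{\Omega}{2}}\,q(\Omega t),\qquad \beta(t)=\sqrt{\tfrac{\Omega}{2}}\,p(\Omega t),\qquad A(t)=\sqrt{N-\alpha(t)^2-\beta(t)^2},\qquad N=\tfrac12\Omega(1+\zeta).$$ Then $\chi=(\alpha,\beta,A)$ is the Josephson tunneling orbit (exterior to the separatrix)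 of $$\dot\alpha=(\Omega+2\alpha^2)\beta,\qquad \dot\beta=-(\Omega+2\alpha^2-2A^2)\alpha,\qquad \dot A=-2\alpha\beta A,$$ with $\alpha(0)=\sqrt{\Omega/2}\,q_0$, $\beta(0)=0$. Its period is $T=\dfrac{4K(k)}{\omega\,\Omega}$. Let $$\tilde M(t)=\Bigl[\ \frac{\partial_{q_0}\chi(t)}{\partial_{q_0}\alpha(0)}\quad \frac{\partial_t\chi(t)}{\partial_t\beta(0)}\quad \frac{\partial_\zeta\chi(t)}{\partial_\zeta A(0)}\ \Bigr],\qquad M(t)=\tilde M(t)\,\tilde M(0)^{-1},$$ where $\chi$ is regarded as a function of $(\Omega,\zeta,q_0,t)$, and let $B(t)$ be the Jacobian matrix of the above vector field at $\chi(t)$. **Lemma.** Let $\tfrac79<\gamma<1$ and $c_1,c_2>0$. There are $C>0$ and $\sigma_0>0$, depending only on $\gamma,c_1,c_2$, such that the following holds for all $0<\sigma<\sigma_0$ and all $\Omega,\zeta,q_0$ with $$c_1\sigma^\gamma\le\Omega\le c_2\sigma^\gamma,\qquad 0<\zeta\le c_2\sigma^{1-\gamma},\qquad q_0\ge\sqrt{\tfrac32\zeta},\qquad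 q_0\ge c_1\sigma^{\frac{1-\gamma}2},\qquad q_0^2<1+\zeta .$$ 1. $M$ is the fundamental matrix of the linearization about $\chi$: $M(0)=I$ and $\dot M(t)=B(t)M(t)$ for all $t\in\mathbb R$. 2. $T\le C\sigma^{-\frac{1+\gamma}2}$; and if moreover $q_0\le c_2\sigma^{\frac{1-\gamma}2}$, then also $\sigma^{-\frac{1+\gamma}2}\le C\,T$. 3. For all $0<t<T$, in the Euclidean operator norm, $\ \|M(t)\|\le C\,\sigma^{\frac{\gamma-1}2}$. -/

import Mathlib

noncomputable section

/-- Incomplete elliptic integral of the first kind with modulus `k`,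
`F(φ, k) = ∫₀^φ dt / √(1 - k² sin² t)`. -/
def ellipticF (φ k : ℝ) : ℝ :=
  ∫ t in (0 : ℝ)..φ, 1 / Real.sqrt (1 - k ^ 2 * Real.sin t ^ 2)

/-- Complete elliptic integral of the first kind, `K(k) = F(π/2, k)`. -/
def ellipticK (k : ℝ) : ℝ := ellipticF (Real.pi / 2) k

/-- Jacobi amplitude: the inverse function of `φ ↦ F(φ, k)`, which for `0 ≤ k < 1` is a
bijection of `ℝ`. -/
def jacobiAm (u k : ℝ) : ℝ := Function.invFun (fun φ : ℝ => ellipticF φ k) u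

/-- Jacobi's `sn(u, k)`. -/
def jacobiSn (u k : ℝ) : ℝ := Real.sin (jacobiAm u k)

/-- Jacobi's `cn(u, k)`. -/
def jacobiCn (u k : ℝ) : ℝ := Real.cos (jacobiAm u k)

namespace DoubleWell

/-- The frequency `ω = √(2 q₀² - ζ)` of the orbit with turning point `q₀`. -/
def freq (ζ q₀ : ℝ) : ℝ := Real.sqrt (2 * q₀ ^ 2 - ζ)

/-- The elliptic modulus, `k² = (1 + ζ - q₀²) q₀² / (2 q₀² - ζ)`. -/
def modulus (ζ q₀ : ℝ) : ℝ :=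
  Real.sqrt ((1 + ζ - q₀ ^ 2) * q₀ ^ 2 / (2 * q₀ ^ 2 - ζ))

/-- The orbit exterior to the separatrix with `q(0) = q₀`, `p(0) = 0`, in rescaled time `τ`. -/
def qOrbit (ζ q₀ τ : ℝ) : ℝ :=
  q₀ * jacobiCn (freq ζ q₀ * τ) (modulus ζ q₀) /
    Real.sqrt (1 + q₀ ^ 2 * jacobiSn (freq ζ q₀ * τ) (modulus ζ q₀) ^ 2)

/-- The conjugate momentum `p = (dq/dτ) / (1 + q²)`. -/
def pOrbit (ζ q₀ τ : ℝ) : ℝ :=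
  deriv (fun s : ℝ => qOrbit ζ q₀ s) τ / (1 + qOrbit ζ q₀ τ ^ 2)

/-- `α(t) = √(Ω/2) q(Ω t)`, where `Ω = Ω₁ - Ω₀`. -/
def alpha (Ω ζ q₀ t : ℝ) : ℝ := Real.sqrt (Ω / 2) * qOrbit ζ q₀ (Ω * t)

/-- `β(t) = √(Ω/2) p(Ω t)`. -/
def beta (Ω ζ q₀ t : ℝ) : ℝ := Real.sqrt (Ω / 2) * pOrbit ζ q₀ (Ω * t)

/-- The power `N`, determined by `ζ = (2N - Ω) / Ω`. -/
def power (Ω ζ : ℝ) : ℝ := Ω * (1 + ζ) / 2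

/-- `A(t) = √(N - α² - β²)`. -/
def amp (Ω ζ q₀ t : ℝ) : ℝ :=
  Real.sqrt (power Ω ζ - alpha Ω ζ q₀ t ^ 2 - beta Ω ζ q₀ t ^ 2)

/-- The orbit `χ = (α, β, A)`. -/
def chi (Ω ζ q₀ t : ℝ) : Fin 3 → ℝ :=
  ![alpha Ω ζ q₀ t, beta Ω ζ q₀ t, amp Ω ζ q₀ t]

/-- The period `T = 4 K(k) / (ω Ω)` of the orbit in the time `t`. -/
def period (Ω ζ q₀ : ℝ) : ℝ :=
  4 * ellipticK (modulus ζ q₀) / (freq ζ q₀ * Ω)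

/-- The matrix with columns `∂χ/∂q₀`, `∂χ/∂t`, `∂χ/∂ζ` at time `t`. -/
def chiDeriv (Ω ζ q₀ t : ℝ) : Matrix (Fin 3) (Fin 3) ℝ :=
  Matrix.of fun i => ![deriv (fun x : ℝ => chi Ω ζ x t i) q₀,
    deriv (fun s : ℝ => chi Ω ζ q₀ s i) t,
    deriv (fun z : ℝ => chi Ω z q₀ t i) ζ]

/-- `M̃(t)`: the columns of `chiDeriv`, each divided by the constant that makes its leading
component at `t = 0` (the `α`, `β`, `A` component respectively) equal to `1`. -/
def Mtilde (Ω ζ q₀ t : ℝ) : Matrix (Fin 3) (Fin 3) ℝ :=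
  Matrix.of fun i j => chiDeriv Ω ζ q₀ t i j / chiDeriv Ω ζ q₀ 0 j j

/-- The fundamental matrix `M(t) = M̃(t) M̃(0)⁻¹`. -/
def M (Ω ζ q₀ t : ℝ) : Matrix (Fin 3) (Fin 3) ℝ :=
  Mtilde Ω ζ q₀ t * (Mtilde Ω ζ q₀ 0)⁻¹

/-- The Jacobian matrix at `χ = (α, β, A)` of the vector field
`α' = (Ω + 2α²) β`, `β' = -(Ω + 2α² - 2A²) α`, `A' = -2αβA`. -/
def jacobian (Ω : ℝ) (χ : Fin 3 → ℝ) : Matrix (Fin 3) (Fin 3) ℝ :=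
  !![4 * χ 0 * χ 1, Ω + 2 * χ 0 ^ 2, 0;
     -(Ω + 6 * χ 0 ^ 2 - 2 * χ 2 ^ 2), 0, 4 * χ 0 * χ 2;
     -2 * χ 2 * χ 1, -2 * χ 0 * χ 2, -2 * χ 0 * χ 1]

end DoubleWell

end

/-! ### Calculus tools: integrals with a parameter, implicit functions, variational equations. -/

open Set Filter Topology MeasureTheory

/-! The elliptic functions are removed by using the angle `y = am(ωτ, k)` as coordinate. Along the
orbit `dy/dτ = √ρ(y)`, where `ρ` (`radicand`) is polynomial in `ζ`, `q` and `sin y`, and `α, β, A`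
are explicit functions of `(ζ, q, y)` (`profile`). Only the angle depends implicitly on the
parameters, through `∫₀^y ds/√ρ = τ`. Differentiating this relation gives `phaseDeriv`, and the
chain rule then gives every column of `chiDeriv`.

Assertion 1 holds because parameter derivatives of a family of solutions solve the linearized
equation. `hasDerivAt_variation` proves this from the symmetry of second derivatives in the explicit
variables `(x, y)`. The time column is the vector field along the orbit, which also solves it. Right
multiplication by a constant matrix (`M_eq`) preserves solutions, and `M(0) = I` because `M̃(0)` is
invertible.

The estimates rest on `q² ≥ 3ζ/2`, which keeps the orbit away from the separatrix: `√ρ` is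
comparable to `q` and `k² ≤ 3/4`, so `K(k)` lies between `π/2` and `π`. Hence `T` is comparable to
`1/(qΩ)`, and the angle stays below `4π` during one period. Over such angles `phaseDeriv` is
`O(q⁻²)`, while the profile depends on the angle with a factor `q` or better, so these contributions
are `O(1/q)`. In the time column, a field of relative size `q²` is divided by a normalization of
relative size `q³`. The possible singularity at `1 + ζ - q² → 0` cancels in the normalized columns.
Thus `‖M‖ = O(1/q)` (`exists_abs_M_le`), and the lower bound on `q₀` finishes the proof. -/

theorem hasDerivAt_integral_inv_sqrt {ρ ρ' : ℝ → ℝ → ℝ} (hρ : Continuous (Function.uncurry ρ))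
    (hρ' : Continuous (Function.uncurry ρ'))
    (hd : ∀ x s, HasDerivAt (fun x => ρ x s) (ρ' x s) x) {x₀ : ℝ}
    (hpos : ∀ᶠ x in 𝓝 x₀, ∀ s, 0 < ρ x s) (y : ℝ) :
    HasDerivAt (fun x => ∫ s in (0 : ℝ)..y, 1 / Real.sqrt (ρ x s))
      (∫ s in (0 : ℝ)..y, -(ρ' x₀ s) / (2 * Real.sqrt (ρ x₀ s) ^ 3)) x₀ := by
  obtain ⟨ε, hε, hball⟩ := Metric.nhds_basis_closedBall.eventually_iff.1 hpos
  have hcont : ContinuousOn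
      (fun p : ℝ × ℝ => -(ρ' p.1 p.2) / (2 * Real.sqrt (ρ p.1 p.2) ^ 3))
      (Metric.closedBall x₀ ε ×ˢ uIcc 0 y) := by
    have h1 : Continuous fun p : ℝ × ℝ => ρ p.1 p.2 := hρ
    have h2 : Continuous fun p : ℝ × ℝ => ρ' p.1 p.2 := hρ'
    refine ContinuousOn.div (by fun_prop) (by fun_prop) ?_
    rintro ⟨x, s⟩ ⟨hx, -⟩
    have := Real.sqrt_pos.2 (hball hx s)
    simp only
    positivity
  -- Compactness of the parameter ball times the integration interval supplies a constant dominating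
  -- function.
  obtain ⟨C, hC⟩ := ((isCompact_closedBall x₀ ε).prod isCompact_uIcc).exists_bound_of_continuousOn
    hcont
  have hsec : ∀ x, Continuous (ρ x) := fun x => hρ.comp (by fun_prop : Continuous fun s => (x, s))
  have hsec' : ∀ x, Continuous (ρ' x) := fun x => hρ'.comp (by fun_prop : Continuous fun s => (x, s))
  have hc : ∀ x ∈ Metric.closedBall x₀ ε, Continuous fun s => 1 / Real.sqrt (ρ x s) := by
    intro x hx
    refine Continuous.div (by fun_prop) (hsec x).sqrt fun s => ?_
    exact (Real.sqrt_pos.2 (hball hx s)).ne'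
  have hx₀ : x₀ ∈ Metric.closedBall x₀ ε := Metric.mem_closedBall_self hε.le
  refine (intervalIntegral.hasDerivAt_integral_of_dominated_loc_of_deriv_le
    (F := fun x s => 1 / Real.sqrt (ρ x s))
    (F' := fun x s => -(ρ' x s) / (2 * Real.sqrt (ρ x s) ^ 3)) (bound := fun _ => C)
    (Metric.closedBall_mem_nhds x₀ hε) ?_ ?_ ?_ ?_ ?_ ?_).2
  · filter_upwards [Metric.closedBall_mem_nhds x₀ hε] with x hx
    exact (hc x hx).aestronglyMeasurable
  · exact (hc x₀ hx₀).intervalIntegrable _ _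
  · refine Continuous.aestronglyMeasurable ?_
    refine Continuous.div (hsec' x₀).neg ((hsec x₀).sqrt.pow 3 |>.const_mul 2) fun s => ?_
    have := Real.sqrt_pos.2 (hball hx₀ s)
    positivity
  · refine Eventually.of_forall fun s hs x hx => ?_
    exact hC (x, s) ⟨hx, uIoc_subset_uIcc hs⟩
  · simp
  · refine Eventually.of_forall fun s _ x hx => ?_
    have hp := hball hx s
    have hs := Real.sqrt_pos.2 hp
    have h : HasDerivAt (fun x => (Real.sqrt (ρ x s))⁻¹) _ x := ((hd x s).sqrt hp.ne').inv hs.ne'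
    simp only [one_div]
    refine h.congr_deriv ?_
    field_simp

/-- The derivative of a function defined implicitly by `J x (φ x) = c`, when `J x` is uniformly
increasing. -/
theorem hasDerivAt_of_implicit {J g : ℝ → ℝ → ℝ} {φ : ℝ → ℝ} {x₀ d m c : ℝ} (hm : 0 < m)
    (hJ : ∀ᶠ x in 𝓝 x₀, ∀ y, HasDerivAt (J x) (g x y) y)
    (hg : ∀ᶠ x in 𝓝 x₀, ∀ y, m ≤ g x y)
    (hgc : ContinuousAt (Function.uncurry g) (x₀, φ x₀))
    (hd : HasDerivAt (fun x => J x (φ x₀)) d x₀)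
    (h0 : ∀ᶠ x in 𝓝 x₀, J x (φ x) = c) :
    HasDerivAt φ (-d / g x₀ (φ x₀)) x₀ := by
  -- The mean value theorem in the second variable replaces joint differentiability of `J`. The
  -- implication sits inside the existential so that `ξ` can be chosen for all `x` at once.
  have key : ∀ x, ∃ ξ ∈ uIcc (φ x₀) (φ x), (∀ y, HasDerivAt (J x) (g x y) y) →
      J x (φ x) - J x (φ x₀) = g x ξ * (φ x - φ x₀) := by
    intro x
    by_cases hx : ∀ y, HasDerivAt (J x) (g x y) y
    swap
    · exact ⟨φ x₀, left_mem_uIcc, fun h => absurd h hx⟩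
    have hcont : Continuous (J x) := continuous_iff_continuousAt.2 fun y => (hx y).continuousAt
    rcases lt_trichotomy (φ x₀) (φ x) with h | h | h
    · obtain ⟨ξ, hξ, he⟩ := exists_hasDerivAt_eq_slope (J x) (g x) h hcont.continuousOn
        fun y _ => hx y
      refine ⟨ξ, ?_, fun _ => ?_⟩
      · rw [uIcc_of_le h.le]; exact Ioo_subset_Icc_self hξ
      · rw [he, div_mul_cancel₀ _ (sub_ne_zero.2 h.ne')]
    · exact ⟨φ x₀, left_mem_uIcc, fun _ => by simp [h]⟩
    · obtain ⟨ξ, hξ, he⟩ := exists_hasDerivAt_eq_slope (J x) (g x) h hcont.continuousOn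
        fun y _ => hx y
      refine ⟨ξ, ?_, fun _ => ?_⟩
      · rw [uIcc_of_ge h.le]; exact Ioo_subset_Icc_self hξ
      · have := sub_ne_zero.2 h.ne'
        rw [he]; field_simp; ring
  choose ξ hξ hmv using key
  have h00 : J x₀ (φ x₀) = c := h0.self_of_nhds
  have heq : ∀ᶠ x in 𝓝 x₀, φ x - φ x₀ = -(J x (φ x₀) - J x₀ (φ x₀)) / g x (ξ x) := by
    filter_upwards [hJ, hg, h0] with x h1 h2 h3
    have hgp := hm.trans_le (h2 (ξ x))
    have := hmv x h1
    rw [eq_div_iff hgp.ne', h00]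
    rw [h3] at this
    linarith
  have hJc : Tendsto (fun x => J x (φ x₀) - J x₀ (φ x₀)) (𝓝 x₀) (𝓝 0) := by
    simpa using hd.continuousAt.tendsto.sub_const (J x₀ (φ x₀))
  -- Continuity of `φ` is not assumed: the uniform lower bound `m` on the slope forces it.
  have hφc : Tendsto (fun x => φ x - φ x₀) (𝓝 x₀) (𝓝 0) := by
    refine squeeze_zero_norm' (a := fun x => |J x (φ x₀) - J x₀ (φ x₀)| / m) ?_ ?_
    · filter_upwards [heq, hg] with x h1 h2
      rw [h1, Real.norm_eq_abs, abs_div, abs_neg, abs_of_pos (hm.trans_le (h2 _))]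
      exact div_le_div_of_nonneg_left (abs_nonneg _) hm (h2 _)
    · simpa using hJc.abs.div_const m
  have hξc : Tendsto ξ (𝓝 x₀) (𝓝 (φ x₀)) := by
    rw [tendsto_iff_norm_sub_tendsto_zero]
    refine squeeze_zero (fun _ => norm_nonneg _) (fun x => ?_) (by simpa using hφc.norm)
    have := abs_sub_left_of_mem_uIcc (hξ x)
    simpa [Real.norm_eq_abs] using this
  have hgξ : Tendsto (fun x => g x (ξ x)) (𝓝 x₀) (𝓝 (g x₀ (φ x₀))) :=
    hgc.tendsto.comp (tendsto_id.prodMk_nhds hξc)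
  have hgpos : g x₀ (φ x₀) ≠ 0 := (hm.trans_le (hg.self_of_nhds _)).ne'
  rw [hasDerivAt_iff_tendsto_slope] at hd ⊢
  have := hd.neg.div (hgξ.mono_left nhdsWithin_le_nhds) hgpos
  refine this.congr' ?_
  filter_upwards [nhdsWithin_le_nhds heq] with x hx
  simp only [slope_def_field, Pi.div_apply]
  rw [hx]
  ring

/-- The derivative of a family of solutions with respect to its parameter solves the variational
equation. -/
theorem hasDerivAt_variation {n : ℕ} {X : Fin n → ℝ × ℝ → ℝ} {r : ℝ × ℝ → ℝ}
    {V : Fin n → (Fin n → ℝ) → ℝ} {x₀ t : ℝ} {φ ψ : ℝ → ℝ}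
    (hX : ∀ i, ContDiffAt ℝ 2 (X i) (x₀, φ t)) (hr : DifferentiableAt ℝ r (x₀, φ t))
    (hV : ∀ i, DifferentiableAt ℝ (V i) (fun j => X j (x₀, φ t)))
    (hφ : HasDerivAt φ (r (x₀, φ t)) t)
    (hψ : HasDerivAt ψ (fderiv ℝ r (x₀, φ t) (1, ψ t)) t)
    (hode : ∀ i, ∀ᶠ z in 𝓝 (x₀, φ t), fderiv ℝ (X i) z (0, 1) * r z = V i (fun j => X j z))
    (i : Fin n) :
    HasDerivAt (fun s => fderiv ℝ (X i) (x₀, φ s) (1, ψ s))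
      (fderiv ℝ (V i) (fun j => X j (x₀, φ t)) (fun j => fderiv ℝ (X j) (x₀, φ t) (1, ψ t))) t := by
  set z₀ : ℝ × ℝ := (x₀, φ t) with hz₀
  have hD : DifferentiableAt ℝ (fderiv ℝ (X i)) z₀ :=
    ((hX i).fderiv_right (m := 1) (by norm_num)).differentiableAt (by norm_num)
  have hsymm := (hX i).isSymmSndFDerivAt (by simp)
  have hz : HasDerivAt (fun s => (x₀, φ s)) ((0 : ℝ), r z₀) t :=
    (hasDerivAt_const t x₀).prodMk hφ
  have hw : HasDerivAt (fun s => ((1 : ℝ), ψ s)) ((0 : ℝ), fderiv ℝ r z₀ (1, ψ t)) t :=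
    (hasDerivAt_const t _).prodMk hψ
  have h1 : HasDerivAt (fun s => fderiv ℝ (X i) (x₀, φ s))
      (fderiv ℝ (fderiv ℝ (X i)) z₀ (0, r z₀)) t :=
    hD.hasFDerivAt.comp_hasDerivAt_of_eq t hz hz₀
  have h2 := h1.clm_apply hw
  refine h2.congr_deriv ?_
  have hXd : ∀ j, DifferentiableAt ℝ (X j) z₀ := fun j => (hX j).differentiableAt (by norm_num)
  -- The identity `∂_y X · r = V ∘ X` is now differentiated in the direction `(1, ψ t)`, the one in
  -- which the solution varies with the parameter.
  have hL : HasFDerivAt (fun z => fderiv ℝ (X i) z (0, 1) * r z) _ z₀ :=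
    (hD.hasFDerivAt.clm_apply (hasFDerivAt_const ((0 : ℝ), (1 : ℝ)) z₀)).mul hr.hasFDerivAt
  have hXX : HasFDerivAt (fun z => fun j => X j z) _ z₀ :=
    hasFDerivAt_pi.2 fun j => (hXd j).hasFDerivAt
  have hR : HasFDerivAt (fun z => V i (fun j => X j z)) _ z₀ :=
    HasFDerivAt.comp z₀ (hV i).hasFDerivAt hXX
  have he := (hL.congr_of_eventuallyEq ((hode i).mono fun z hz => hz.symm)).unique hR
  have he' := congrArg (fun L => L ((1 : ℝ), ψ t)) he
  have hpi : (fun j => fderiv ℝ (X j) z₀ (1, ψ t)) =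
      (ContinuousLinearMap.pi fun j => fderiv ℝ (X j) z₀) (1, ψ t) := by ext j; rfl
  simp only [_root_.add_apply, _root_.smul_apply,
    ContinuousLinearMap.comp_apply, smul_eq_mul, ContinuousLinearMap.flip_apply,
    _root_.zero_apply, map_zero, zero_add] at he'
  rw [hpi, ← he']
  have e1 : ((0 : ℝ), r z₀) = r z₀ • ((0 : ℝ), (1 : ℝ)) := by simp
  have e2 : ((0 : ℝ), fderiv ℝ r z₀ (1, ψ t)) = fderiv ℝ r z₀ (1, ψ t) • ((0 : ℝ), (1 : ℝ)) := by
    simp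
  rw [e1, e2, map_smul, map_smul, _root_.smul_apply, hsymm]
  simp only [smul_eq_mul]
  ring

/-! ### The elliptic integral and its inverse. -/

theorem one_sub_sq_mul_sin_sq_pos {k : ℝ} (hk : k ^ 2 < 1) (t : ℝ) :
    0 < 1 - k ^ 2 * Real.sin t ^ 2 := by
  nlinarith [Real.sin_sq_le_one t, sq_nonneg k, sq_nonneg (Real.sin t)]

theorem hasDerivAt_ellipticF {k : ℝ} (hk : k ^ 2 < 1) (φ : ℝ) :
    HasDerivAt (fun φ => ellipticF φ k) (1 / Real.sqrt (1 - k ^ 2 * Real.sin φ ^ 2)) φ := by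
  have hc : Continuous fun t : ℝ => 1 / Real.sqrt (1 - k ^ 2 * Real.sin t ^ 2) :=
    Continuous.div (by fun_prop) (by fun_prop) fun t =>
      (Real.sqrt_pos.2 (one_sub_sq_mul_sin_sq_pos hk t)).ne'
  exact (hc.integral_hasStrictDerivAt 0 φ).hasDerivAt

@[simp] theorem ellipticF_zero (k : ℝ) : ellipticF 0 k = 0 := by simp [ellipticF]

/-- The integrand is at least 1. Comparison with the identity yields both surjectivity of `F(·, k)`
and the angle bound `|φ| ≤ |F(φ, k)|`. -/
theorem monotone_ellipticF_sub_self {k : ℝ} (hk : k ^ 2 < 1) :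
    Monotone fun φ => ellipticF φ k - φ := by
  have hd := fun φ => (hasDerivAt_ellipticF hk φ).sub (hasDerivAt_id φ)
  refine monotone_of_deriv_nonneg (fun φ => (hd φ).differentiableAt) fun φ => ?_
  have hp := Real.sqrt_pos.2 (one_sub_sq_mul_sin_sq_pos hk φ)
  have h1 : Real.sqrt (1 - k ^ 2 * Real.sin φ ^ 2) ≤ 1 := by
    refine Real.sqrt_le_iff.2 ⟨zero_le_one, ?_⟩
    nlinarith [mul_nonneg (sq_nonneg k) (sq_nonneg (Real.sin φ))]
  have h2 := (hd φ).deriv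
  have h3 : (1 : ℝ) ≤ 1 / Real.sqrt (1 - k ^ 2 * Real.sin φ ^ 2) := by
    rwa [le_div_iff₀ hp, one_mul]
  have h4 : deriv (fun φ => ellipticF φ k - φ) φ =
    1 / Real.sqrt (1 - k ^ 2 * Real.sin φ ^ 2) - 1 := h2
  rw [h4]
  linarith

theorem self_le_ellipticF {k φ : ℝ} (hk : k ^ 2 < 1) (hφ : 0 ≤ φ) : φ ≤ ellipticF φ k := by
  have := monotone_ellipticF_sub_self hk hφ
  simp only [ellipticF_zero] at this
  linarith

theorem ellipticF_le_self {k φ : ℝ} (hk : k ^ 2 < 1) (hφ : φ ≤ 0) : ellipticF φ k ≤ φ := by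
  have := monotone_ellipticF_sub_self hk hφ
  simp only [ellipticF_zero] at this
  linarith

theorem abs_le_abs_ellipticF {k : ℝ} (hk : k ^ 2 < 1) (φ : ℝ) : |φ| ≤ |ellipticF φ k| := by
  rcases le_total 0 φ with h | h
  · have := self_le_ellipticF hk h
    rw [abs_of_nonneg h, abs_of_nonneg (h.trans this)]
    exact this
  · have := ellipticF_le_self hk h
    rw [abs_of_nonpos h, abs_of_nonpos (this.trans h)]
    linarith

theorem surjective_ellipticF {k : ℝ} (hk : k ^ 2 < 1) :
    Function.Surjective fun φ => ellipticF φ k := by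
  have hc : Continuous fun φ => ellipticF φ k :=
    continuous_iff_continuousAt.2 fun φ => (hasDerivAt_ellipticF hk φ).continuousAt
  refine hc.surjective ?_ ?_
  · exact tendsto_atTop_mono' atTop
      ((eventually_ge_atTop 0).mono fun φ hφ => self_le_ellipticF hk hφ) tendsto_id
  · exact tendsto_atBot_mono' atBot
      ((eventually_le_atBot 0).mono fun φ hφ => ellipticF_le_self hk hφ) tendsto_id

theorem ellipticF_jacobiAm {k : ℝ} (hk : k ^ 2 < 1) (u : ℝ) : ellipticF (jacobiAm u k) k = u :=
  Function.invFun_eq (f := fun φ => ellipticF φ k) (surjective_ellipticF hk u)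

theorem pi_div_two_le_ellipticK {k : ℝ} (hk : k ^ 2 < 1) : Real.pi / 2 ≤ ellipticK k :=
  self_le_ellipticF hk (by positivity)

/-- For `k² ≤ 3/4` the integrand is at most 2 on an interval of length `π/2`. -/
theorem ellipticK_le_pi {k : ℝ} (hk : k ^ 2 ≤ 3 / 4) : ellipticK k ≤ Real.pi := by
  have h : ‖ellipticK k‖ ≤ 2 * |Real.pi / 2 - 0| := by
    refine intervalIntegral.norm_integral_le_of_norm_le_const fun t _ => ?_
    have h1 : 1 / 4 ≤ 1 - k ^ 2 * Real.sin t ^ 2 := by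
      nlinarith [Real.sin_sq_le_one t, sq_nonneg k, sq_nonneg (Real.sin t)]
    have h2 : 1 / 2 ≤ Real.sqrt (1 - k ^ 2 * Real.sin t ^ 2) :=
      Real.le_sqrt_of_sq_le (by linarith)
    rw [Real.norm_eq_abs, abs_of_nonneg (by positivity), div_le_iff₀ (by linarith)]
    linarith
  rw [sub_zero, abs_of_pos (by positivity)] at h
  linarith [le_abs_self (ellipticK k), Real.norm_eq_abs (ellipticK k)]

/-! ### The angle along the orbit and its dependence on the parameters. -/

namespace DoubleWell

/-- Parameters of a nonconstant orbit exterior to the separatrix with positive amplitude. -/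
structure Exterior (ζ q : ℝ) : Prop where
  pos : 0 < q
  lt_sq : ζ < q ^ 2
  sq_lt : q ^ 2 < 1 + ζ

/-- The square of the angular velocity at the angle `y`. -/
noncomputable def radicand (ζ q y : ℝ) : ℝ :=
  2 * q ^ 2 - ζ - (1 + ζ - q ^ 2) * q ^ 2 * Real.sin y ^ 2

/-- The derivative of `radicand` in the direction `(ζ', q')` of the parameters. -/
noncomputable def radicandDeriv (ζ q ζ' q' y : ℝ) : ℝ :=
  4 * q * q' - ζ' - ((ζ' - 2 * q * q') * q ^ 2 + (1 + ζ - q ^ 2) * (2 * q * q')) * Real.sin y ^ 2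

/-- The angle along the orbit with parameters `ζ`, `q` at the rescaled time `τ`. -/
noncomputable def phase (ζ q τ : ℝ) : ℝ := jacobiAm (freq ζ q * τ) (modulus ζ q)

/-- The derivative of the angle in the direction `(ζ', q')` of the parameters, as a function of
the angle. -/
noncomputable def phaseDeriv (ζ q ζ' q' y : ℝ) : ℝ :=
  Real.sqrt (radicand ζ q y) *
    ∫ s in (0 : ℝ)..y, radicandDeriv ζ q ζ' q' s / (2 * Real.sqrt (radicand ζ q s) ^ 3)

namespace Exterior

variable {ζ q : ℝ}

theorem freqSq_pos (h : Exterior ζ q) : 0 < 2 * q ^ 2 - ζ := by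
  have := pow_pos h.pos 2
  linarith [h.lt_sq]

/-- The minimum is attained at `sin² y = 1`, where the radicand factors. It vanishes exactly on the
separatrix `q² = ζ`. -/
theorem radicand_ge (h : Exterior ζ q) (y : ℝ) : (q ^ 2 - ζ) * (1 + q ^ 2) ≤ radicand ζ q y := by
  have h1 := mul_nonneg (sub_pos.2 h.sq_lt).le (sq_nonneg q)
  have h2 := mul_nonneg h1 (sub_nonneg.2 (Real.sin_sq_le_one y))
  unfold radicand
  nlinarith

theorem radicand_le (h : Exterior ζ q) (y : ℝ) : radicand ζ q y ≤ 2 * q ^ 2 - ζ := by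
  have h1 := mul_nonneg (sub_pos.2 h.sq_lt).le (sq_nonneg q)
  have h2 := mul_nonneg h1 (sq_nonneg (Real.sin y))
  unfold radicand
  nlinarith

theorem radicand_pos (h : Exterior ζ q) (y : ℝ) : 0 < radicand ζ q y :=
  (mul_pos (sub_pos.2 h.lt_sq) (by positivity)).trans_le (h.radicand_ge y)

theorem modulus_sq (h : Exterior ζ q) :
    modulus ζ q ^ 2 = (1 + ζ - q ^ 2) * q ^ 2 / (2 * q ^ 2 - ζ) :=
  Real.sq_sqrt (div_nonneg (mul_nonneg (sub_pos.2 h.sq_lt).le (sq_nonneg q)) h.freqSq_pos.le)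

theorem modulus_sq_lt_one (h : Exterior ζ q) : modulus ζ q ^ 2 < 1 := by
  rw [h.modulus_sq, div_lt_one h.freqSq_pos]
  have := mul_pos (sub_pos.2 h.lt_sq) (by positivity : 0 < 1 + q ^ 2)
  nlinarith

theorem sqrt_radicand (h : Exterior ζ q) (y : ℝ) :
    Real.sqrt (radicand ζ q y) =
      freq ζ q * Real.sqrt (1 - modulus ζ q ^ 2 * Real.sin y ^ 2) := by
  rw [freq, ← Real.sqrt_mul h.freqSq_pos.le, h.modulus_sq]
  congr 1
  have := h.freqSq_pos.ne'
  unfold radicand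
  field_simp

theorem freq_pos (h : Exterior ζ q) : 0 < freq ζ q := Real.sqrt_pos.2 h.freqSq_pos

/-- The implicit equation for the angle, free of elliptic functions; everything later about `phase`
as a function of time or parameters is derived from it, except the size bound `abs_phase_le`. -/
theorem integral_phase (h : Exterior ζ q) (τ : ℝ) :
    ∫ s in (0 : ℝ)..phase ζ q τ, 1 / Real.sqrt (radicand ζ q s) = τ := by
  have h1 : ∀ s, 1 / Real.sqrt (radicand ζ q s) =
      (freq ζ q)⁻¹ * (1 / Real.sqrt (1 - modulus ζ q ^ 2 * Real.sin s ^ 2)) := by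
    intro s
    rw [h.sqrt_radicand, one_div, mul_inv, one_div]
  simp only [h1]
  rw [intervalIntegral.integral_const_mul]
  have h2 := ellipticF_jacobiAm h.modulus_sq_lt_one (freq ζ q * τ)
  unfold ellipticF at h2
  rw [phase, h2, inv_mul_cancel_left₀ h.freq_pos.ne']

theorem abs_phase_le (h : Exterior ζ q) (τ : ℝ) : |phase ζ q τ| ≤ |freq ζ q * τ| := by
  have := abs_le_abs_ellipticF h.modulus_sq_lt_one (phase ζ q τ)
  rwa [phase, ellipticF_jacobiAm h.modulus_sq_lt_one] at this

theorem phase_zero (h : Exterior ζ q) : phase ζ q 0 = 0 := by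
  simpa using h.abs_phase_le 0

theorem continuous_inv_sqrt_radicand (h : Exterior ζ q) :
    Continuous fun s => 1 / Real.sqrt (radicand ζ q s) := by
  refine Continuous.div (by fun_prop) ?_ fun s => (Real.sqrt_pos.2 (h.radicand_pos s)).ne'
  unfold radicand
  fun_prop

theorem hasDerivAt_integral (h : Exterior ζ q) (y : ℝ) :
    HasDerivAt (fun y => ∫ s in (0 : ℝ)..y, 1 / Real.sqrt (radicand ζ q s))
      (1 / Real.sqrt (radicand ζ q y)) y :=
  (h.continuous_inv_sqrt_radicand.integral_hasStrictDerivAt 0 y).hasDerivAt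

theorem le_inv_sqrt_radicand (h : Exterior ζ q) {w : ℝ} (hw : 2 * q ^ 2 - ζ ≤ w) (y : ℝ) :
    1 / Real.sqrt w ≤ 1 / Real.sqrt (radicand ζ q y) :=
  one_div_le_one_div_of_le (Real.sqrt_pos.2 (h.radicand_pos y))
    (Real.sqrt_le_sqrt ((h.radicand_le y).trans hw))

theorem hasDerivAt_phase (h : Exterior ζ q) (τ : ℝ) :
    HasDerivAt (phase ζ q) (Real.sqrt (radicand ζ q (phase ζ q τ))) τ := by
  -- Time itself plays the role of the parameter here.
  have := hasDerivAt_of_implicit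
    (J := fun x y => (∫ s in (0 : ℝ)..y, 1 / Real.sqrt (radicand ζ q s)) - x)
    (g := fun _ y => 1 / Real.sqrt (radicand ζ q y)) (φ := phase ζ q) (x₀ := τ) (d := -1) (c := 0)
    (one_div_pos.2 (Real.sqrt_pos.2 h.freqSq_pos))
    (Eventually.of_forall fun x y => (h.hasDerivAt_integral y).sub_const x)
    (Eventually.of_forall fun _ y => h.le_inv_sqrt_radicand le_rfl y)
    (h.continuous_inv_sqrt_radicand.comp continuous_snd).continuousAt
    ((hasDerivAt_id τ).const_sub _)
    (Eventually.of_forall fun x => by simp only [h.integral_phase, sub_self])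
  simpa using this

end Exterior

section Family

variable {zf qf : ℝ → ℝ} {x₀ : ℝ}

theorem eventually_exterior (hz : ContinuousAt zf x₀) (hq : ContinuousAt qf x₀)
    (h : Exterior (zf x₀) (qf x₀)) : ∀ᶠ x in 𝓝 x₀, Exterior (zf x) (qf x) := by
  filter_upwards [continuousAt_const.eventually_lt hq h.pos,
    hz.eventually_lt (hq.pow 2) h.lt_sq,
    (hq.pow 2).eventually_lt (continuousAt_const.add hz) h.sq_lt] with x h1 h2 h3
  exact ⟨h1, h2, h3⟩

theorem hasDerivAt_radicand (hz : DifferentiableAt ℝ zf x₀) (hq : DifferentiableAt ℝ qf x₀)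
    (y : ℝ) : HasDerivAt (fun x => radicand (zf x) (qf x) y)
      (radicandDeriv (zf x₀) (qf x₀) (deriv zf x₀) (deriv qf x₀) y) x₀ := by
  have h1 := hz.hasDerivAt
  have h2 := hq.hasDerivAt.pow 2
  have h3 := ((h2.const_mul 2).sub h1).sub
    ((((h1.const_add 1).sub h2).mul h2).mul_const (Real.sin y ^ 2))
  refine h3.congr_deriv ?_
  simp only [radicandDeriv, Pi.sub_apply, Pi.pow_apply]
  ring

/-- A curve `(zf, qf)` in parameter space treats the `ζ` and `q₀` derivatives together. -/
theorem hasDerivAt_phase_family (hz : ContDiff ℝ 2 zf) (hq : ContDiff ℝ 2 qf)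
    (h : Exterior (zf x₀) (qf x₀)) (τ : ℝ) :
    HasDerivAt (fun x => phase (zf x) (qf x) τ)
      (phaseDeriv (zf x₀) (qf x₀) (deriv zf x₀) (deriv qf x₀) (phase (zf x₀) (qf x₀) τ)) x₀ := by
  have hzc := hz.continuous
  have hqc := hq.continuous
  have hz1 := hz.continuous_deriv (by norm_num)
  have hq1 := hq.continuous_deriv (by norm_num)
  have hzd := hz.differentiable (by norm_num)
  have hqd := hq.differentiable (by norm_num)
  have hev := eventually_exterior hzc.continuousAt hqc.continuousAt h
  -- The slack 1 makes the upper bound on the radicand, hence the lower bound on the slope, uniform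
  -- for nearby parameters.
  have hlt : ∀ᶠ x in 𝓝 x₀, 2 * qf x ^ 2 - zf x < 2 * qf x₀ ^ 2 - zf x₀ + 1 :=
    ContinuousAt.eventually_lt (by fun_prop) continuousAt_const (by linarith)
  have hρ : Continuous (Function.uncurry fun x s => radicand (zf x) (qf x) s) := by
    unfold radicand Function.uncurry; fun_prop
  have hρ' : Continuous (Function.uncurry fun x s =>
      radicandDeriv (zf x) (qf x) (deriv zf x) (deriv qf x) s) := by
    unfold radicandDeriv Function.uncurry; fun_prop
  have hpos := h.radicand_pos (phase (zf x₀) (qf x₀) τ)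
  have key := hasDerivAt_of_implicit
    (J := fun x y => ∫ s in (0 : ℝ)..y, 1 / Real.sqrt (radicand (zf x) (qf x) s))
    (g := fun x y => 1 / Real.sqrt (radicand (zf x) (qf x) y))
    (φ := fun x => phase (zf x) (qf x) τ) (x₀ := x₀) (c := τ)
    (one_div_pos.2 (Real.sqrt_pos.2 (by linarith [h.freqSq_pos] :
      0 < 2 * qf x₀ ^ 2 - zf x₀ + 1)))
    (hev.mono fun x hx y => hx.hasDerivAt_integral y)
    (hev.mp (hlt.mono fun x hx hx' y => hx'.le_inv_sqrt_radicand hx.le y))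
    (ContinuousAt.div continuousAt_const hρ.continuousAt.sqrt (Real.sqrt_pos.2 hpos).ne')
    (hasDerivAt_integral_inv_sqrt hρ hρ' (fun x s => hasDerivAt_radicand (hzd x) (hqd x) s)
      (hev.mono fun x hx s => hx.radicand_pos s) _)
    (hev.mono fun x hx => hx.integral_phase τ)
  refine key.congr_deriv ?_
  simp only [neg_div, intervalIntegral.integral_neg, neg_neg, phaseDeriv]
  rw [div_div_eq_mul_div, div_one, mul_comm]

end Family

end DoubleWell

/-! ### The orbit as an explicit function of the angle. -/

namespace DoubleWell

/-- The common denominator of the components of the orbit, as a function of the angle. -/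
noncomputable def denom (q y : ℝ) : ℝ := Real.sqrt (1 + q ^ 2 * Real.sin y ^ 2)

/-- The position `q` on the orbit, as a function of the angle. -/
noncomputable def posProfile (q y : ℝ) : ℝ := q * Real.cos y / denom q y

/-- The momentum `p` on the orbit, as a function of the angle. -/
noncomputable def momProfile (ζ q y : ℝ) : ℝ :=
  -(q * Real.sin y * Real.sqrt (radicand ζ q y) / denom q y)

/-- The rescaled amplitude on the orbit, as a function of the angle. -/
noncomputable def ampProfile (ζ q y : ℝ) : ℝ := Real.sqrt (1 + ζ - q ^ 2) * denom q y

/-- The orbit `χ` as a function of the angle. -/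
noncomputable def profile (Ω ζ q y : ℝ) : Fin 3 → ℝ :=
  ![Real.sqrt (Ω / 2) * posProfile q y, Real.sqrt (Ω / 2) * momProfile ζ q y,
    Real.sqrt (Ω / 2) * ampProfile ζ q y]

@[simp] theorem denom_zero (q : ℝ) : denom q 0 = 1 := by simp [denom]

theorem one_le_denom (q y : ℝ) : 1 ≤ denom q y := by
  refine Real.le_sqrt_of_sq_le ?_
  nlinarith [mul_nonneg (sq_nonneg q) (sq_nonneg (Real.sin y))]

theorem denom_pos (q y : ℝ) : 0 < denom q y := zero_lt_one.trans_le (one_le_denom q y)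

theorem denom_sq (q y : ℝ) : denom q y ^ 2 = 1 + q ^ 2 * Real.sin y ^ 2 :=
  Real.sq_sqrt (by positivity)

/-- The derivative of `denom` in the direction `(q', y')`. -/
noncomputable def denomDeriv (q q' y y' : ℝ) : ℝ :=
  (q * q' * Real.sin y ^ 2 + q ^ 2 * Real.sin y * Real.cos y * y') / denom q y

/-- The derivative of the square root of `radicand` in the direction `(ζ', q', y')`. -/
noncomputable def rateDeriv (ζ q ζ' q' y y' : ℝ) : ℝ :=
  (radicandDeriv ζ q ζ' q' y - 2 * ((1 + ζ - q ^ 2) * q ^ 2) * Real.sin y * Real.cos y * y') /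
    (2 * Real.sqrt (radicand ζ q y))

/-- This and the next two are directional derivatives of the three profiles, left expanded so that
powers of `q` can be counted term by term. -/
noncomputable def posDeriv (q q' y y' : ℝ) : ℝ :=
  (q' * Real.cos y - q * Real.sin y * y') / denom q y -
    q * Real.cos y * denomDeriv q q' y y' / denom q y ^ 2

noncomputable def momDeriv (ζ q ζ' q' y y' : ℝ) : ℝ :=
  -((q' * Real.sin y + q * Real.cos y * y') * Real.sqrt (radicand ζ q y) / denom q y +
    q * Real.sin y * rateDeriv ζ q ζ' q' y y' / denom q y -
    q * Real.sin y * Real.sqrt (radicand ζ q y) * denomDeriv q q' y y' / denom q y ^ 2)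

noncomputable def ampDeriv (ζ q ζ' q' y y' : ℝ) : ℝ :=
  (ζ' - 2 * q * q') / (2 * Real.sqrt (1 + ζ - q ^ 2)) * denom q y +
    Real.sqrt (1 + ζ - q ^ 2) * denomDeriv q q' y y'

/-- The derivative of `profile` in the direction `(ζ', q', y')`. -/
noncomputable def profileDeriv (Ω ζ q ζ' q' y y' : ℝ) : Fin 3 → ℝ :=
  ![Real.sqrt (Ω / 2) * posDeriv q q' y y', Real.sqrt (Ω / 2) * momDeriv ζ q ζ' q' y y',
    Real.sqrt (Ω / 2) * ampDeriv ζ q ζ' q' y y']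

section Chain

variable {zf qf φ : ℝ → ℝ} {x₀ ζ' q' y' : ℝ}

theorem hasDerivAt_denom (hq : HasDerivAt qf q' x₀) (hφ : HasDerivAt φ y' x₀) :
    HasDerivAt (fun x => denom (qf x) (φ x)) (denomDeriv (qf x₀) q' (φ x₀) y') x₀ := by
  have h := (((hq.pow 2).mul (hφ.sin.pow 2)).const_add 1).sqrt
    (by simp only [Pi.mul_apply, Pi.pow_apply]; positivity)
  refine h.congr_deriv ?_
  simp only [denomDeriv, denom, Pi.mul_apply, Pi.pow_apply]
  rw [div_eq_div_iff (by positivity) (by positivity)]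
  ring

theorem hasDerivAt_rate (hz : HasDerivAt zf ζ' x₀) (hq : HasDerivAt qf q' x₀)
    (hφ : HasDerivAt φ y' x₀) (h : Exterior (zf x₀) (qf x₀)) :
    HasDerivAt (fun x => Real.sqrt (radicand (zf x) (qf x) (φ x)))
      (rateDeriv (zf x₀) (qf x₀) ζ' q' (φ x₀) y') x₀ := by
  have h2 := hq.pow 2
  have h3 : HasDerivAt (fun x => radicand (zf x) (qf x) (φ x)) _ x₀ := ((h2.const_mul 2).sub hz).sub
    ((((hz.const_add 1).sub h2).mul h2).mul (hφ.sin.pow 2))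
  refine (h3.sqrt (h.radicand_pos _).ne').congr_deriv ?_
  simp only [rateDeriv, radicandDeriv, Pi.sub_apply, Pi.pow_apply, Pi.mul_apply]
  congr 1
  ring

theorem hasDerivAt_posProfile (hq : HasDerivAt qf q' x₀) (hφ : HasDerivAt φ y' x₀) :
    HasDerivAt (fun x => posProfile (qf x) (φ x)) (posDeriv (qf x₀) q' (φ x₀) y') x₀ := by
  have hD := (denom_pos (qf x₀) (φ x₀)).ne'
  refine ((hq.mul hφ.cos).div (hasDerivAt_denom hq hφ) hD).congr_deriv ?_
  simp only [posDeriv, Pi.mul_apply]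
  field_simp
  ring

theorem hasDerivAt_momProfile (hz : HasDerivAt zf ζ' x₀) (hq : HasDerivAt qf q' x₀)
    (hφ : HasDerivAt φ y' x₀) (h : Exterior (zf x₀) (qf x₀)) :
    HasDerivAt (fun x => momProfile (zf x) (qf x) (φ x))
      (momDeriv (zf x₀) (qf x₀) ζ' q' (φ x₀) y') x₀ := by
  have hD := (denom_pos (qf x₀) (φ x₀)).ne'
  refine (((hq.mul hφ.sin).mul (hasDerivAt_rate hz hq hφ h)).div
    (hasDerivAt_denom hq hφ) hD).neg.congr_deriv ?_
  simp only [momDeriv, Pi.mul_apply]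
  field_simp

theorem hasDerivAt_ampProfile (hz : HasDerivAt zf ζ' x₀) (hq : HasDerivAt qf q' x₀)
    (hφ : HasDerivAt φ y' x₀) (h : Exterior (zf x₀) (qf x₀)) :
    HasDerivAt (fun x => ampProfile (zf x) (qf x) (φ x))
      (ampDeriv (zf x₀) (qf x₀) ζ' q' (φ x₀) y') x₀ := by
  have h1 := ((hz.const_add 1).sub (hq.pow 2)).sqrt (sub_pos.2 h.sq_lt).ne'
  refine (h1.mul (hasDerivAt_denom hq hφ)).congr_deriv ?_
  simp [ampDeriv]

theorem hasDerivAt_profile (Ω : ℝ) (hz : HasDerivAt zf ζ' x₀) (hq : HasDerivAt qf q' x₀)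
    (hφ : HasDerivAt φ y' x₀) (h : Exterior (zf x₀) (qf x₀)) (i : Fin 3) :
    HasDerivAt (fun x => profile Ω (zf x) (qf x) (φ x) i)
      (profileDeriv Ω (zf x₀) (qf x₀) ζ' q' (φ x₀) y' i) x₀ := by
  fin_cases i
  · exact (hasDerivAt_posProfile hq hφ).const_mul _
  · exact (hasDerivAt_momProfile hz hq hφ h).const_mul _
  · exact (hasDerivAt_ampProfile hz hq hφ h).const_mul _

end Chain

/-- The vector field `(α, β, A) ↦ ((Ω + 2α²) β, -(Ω + 2α² - 2A²) α, -2αβA)`. -/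
def field (Ω : ℝ) (i : Fin 3) (χ : Fin 3 → ℝ) : ℝ :=
  ![(Ω + 2 * χ 0 ^ 2) * χ 1, -(Ω + 2 * χ 0 ^ 2 - 2 * χ 2 ^ 2) * χ 0, -2 * χ 0 * χ 1 * χ 2] i

theorem hasFDerivAt_field (Ω : ℝ) (i : Fin 3) (χ : Fin 3 → ℝ) :
    HasFDerivAt (field Ω i)
      (∑ j, jacobian Ω χ i j • ContinuousLinearMap.proj (R := ℝ) (φ := fun _ : Fin 3 => ℝ) j) χ := by
  have h : ∀ j : Fin 3, HasFDerivAt (fun χ : Fin 3 → ℝ => χ j)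
      (ContinuousLinearMap.proj (R := ℝ) (φ := fun _ : Fin 3 => ℝ) j) χ :=
    fun j => hasFDerivAt_apply j χ
  fin_cases i
  · have h1 : HasFDerivAt (field Ω 0) _ χ := ((((h 0).pow 2).const_mul 2).const_add Ω).mul (h 1)
    refine h1.congr_fderiv ?_
    ext v
    simp [jacobian, Fin.sum_univ_three]
    ring
  · have h1 : HasFDerivAt (field Ω 1) _ χ :=
      (((((h 0).pow 2).const_mul 2).const_add Ω).sub (((h 2).pow 2).const_mul 2)).neg.mul (h 0)
    refine h1.congr_fderiv ?_
    ext v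
    simp [jacobian, Fin.sum_univ_three]
    ring
  · have h1 : HasFDerivAt (field Ω 2) _ χ := (((h 0).const_mul (-2)).mul (h 1)).mul (h 2)
    refine h1.congr_fderiv ?_
    ext v
    simp [jacobian, Fin.sum_univ_three]
    ring

theorem posDeriv_rate (ζ q y : ℝ) :
    posDeriv q 0 y (Real.sqrt (radicand ζ q y)) = (1 + posProfile q y ^ 2) * momProfile ζ q y := by
  have hD := denom_pos q y
  simp only [posDeriv, posProfile, momProfile, denomDeriv]
  field_simp
  ring

namespace Exterior

variable {ζ q : ℝ}

theorem rate_pos (h : Exterior ζ q) (y : ℝ) : 0 < Real.sqrt (radicand ζ q y) :=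
  Real.sqrt_pos.2 (h.radicand_pos y)

theorem rate_sq (h : Exterior ζ q) (y : ℝ) : Real.sqrt (radicand ζ q y) ^ 2 = radicand ζ q y :=
  Real.sq_sqrt (h.radicand_pos y).le

theorem amp_zero_pos (h : Exterior ζ q) : 0 < Real.sqrt (1 + ζ - q ^ 2) :=
  Real.sqrt_pos.2 (sub_pos.2 h.sq_lt)

theorem amp_zero_sq (h : Exterior ζ q) : Real.sqrt (1 + ζ - q ^ 2) ^ 2 = 1 + ζ - q ^ 2 :=
  Real.sq_sqrt (sub_pos.2 h.sq_lt).le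

/-- Conservation of `α² + β² + A²`, as an algebraic identity at every angle. It exhibits the square
root defining `A` as a smooth positive expression. -/
theorem profile_power (h : Exterior ζ q) (y : ℝ) :
    1 + ζ - posProfile q y ^ 2 - momProfile ζ q y ^ 2 = ampProfile ζ q y ^ 2 := by
  have hD := denom_pos q y
  have hD2 := denom_sq q y
  have hR2 := h.rate_sq y
  have hA2 := h.amp_zero_sq
  have hc := Real.sin_sq_add_cos_sq y
  simp only [posProfile, momProfile, ampProfile, neg_sq, div_pow, mul_pow, hA2, hR2]
  have hc' : Real.cos y ^ 2 = 1 - Real.sin y ^ 2 := by linarith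
  have : denom q y ^ 2 ≠ 0 := by positivity
  have hD4 : denom q y ^ 4 = (1 + q ^ 2 * Real.sin y ^ 2) ^ 2 := by rw [← hD2]; ring
  field_simp
  rw [hD4, hD2, hc', radicand]
  ring

theorem momDeriv_rate (h : Exterior ζ q) (y : ℝ) :
    momDeriv ζ q 0 0 y (Real.sqrt (radicand ζ q y)) =
      -(1 + posProfile q y ^ 2 - ampProfile ζ q y ^ 2) * posProfile q y := by
  have hD := denom_pos q y
  have hD2 := denom_sq q y
  have hR := h.rate_pos y
  have hR2 := h.rate_sq y
  have hc := Real.sin_sq_add_cos_sq y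
  have hc' : Real.cos y ^ 2 = 1 - Real.sin y ^ 2 := by linarith
  rw [← h.profile_power y]
  simp only [momDeriv, rateDeriv, radicandDeriv, posProfile, momProfile, denomDeriv]
  have e : ∀ a b : ℝ, 4 * q * 0 - 0 - ((0 - 2 * q * 0) * q ^ 2 + (1 + ζ - q ^ 2) * (2 * q * 0)) * a
    - b = -b := fun a b => by ring
  rw [e]
  generalize Real.sqrt (radicand ζ q y) = R at *
  generalize denom q y = D at *
  unfold radicand at hR2
  generalize Real.sin y = s at *
  generalize Real.cos y = c at *
  field_simp
  rw [hD2, hc']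
  linear_combination (q ^ 3 * s ^ 2 * c - q * c) * hR2

theorem ampDeriv_rate (h : Exterior ζ q) (y : ℝ) :
    ampDeriv ζ q 0 0 y (Real.sqrt (radicand ζ q y)) =
      -(posProfile q y * momProfile ζ q y * ampProfile ζ q y) := by
  have hD := denom_pos q y
  have hA := h.amp_zero_pos
  simp only [ampDeriv, posProfile, momProfile, ampProfile, denomDeriv]
  field_simp
  ring

/-- The equations of motion with the angular velocity substituted. They hold at every angle, not
just along one trajectory, which is what allows differentiating them in the parameters. -/
theorem profileDeriv_rate (h : Exterior ζ q) {Ω : ℝ} (hΩ : 0 < Ω) (y : ℝ) (i : Fin 3) :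
    Ω * profileDeriv Ω ζ q 0 0 y (Real.sqrt (radicand ζ q y)) i =
      field Ω i (profile Ω ζ q y) := by
  have hs : Real.sqrt (Ω / 2) ^ 2 = Ω / 2 := Real.sq_sqrt (by positivity)
  simp only [profileDeriv, profile, posDeriv_rate, h.momDeriv_rate, h.ampDeriv_rate]
  generalize Real.sqrt (Ω / 2) = S at *
  obtain rfl : Ω = 2 * S ^ 2 := by linarith
  fin_cases i <;> simp [field] <;> ring

theorem hasDerivAt_profile_phase (h : Exterior ζ q) {Ω : ℝ} (hΩ : 0 < Ω) (t : ℝ) (i : Fin 3) :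
    HasDerivAt (fun t => profile Ω ζ q (phase ζ q (Ω * t)) i)
      (field Ω i (profile Ω ζ q (phase ζ q (Ω * t)))) t := by
  have h1 : HasDerivAt (fun t => phase ζ q (Ω * t))
      (Ω * Real.sqrt (radicand ζ q (phase ζ q (Ω * t)))) t := by
    have := (h.hasDerivAt_phase (Ω * t)).comp t ((hasDerivAt_id t).const_mul Ω)
    refine this.congr_deriv (by ring)
  have h2 : HasDerivAt (fun y => profile Ω ζ q y i)
      (profileDeriv Ω ζ q 0 0 (phase ζ q (Ω * t)) 1 i) (phase ζ q (Ω * t)) :=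
    hasDerivAt_profile Ω (hasDerivAt_const _ ζ) (hasDerivAt_const _ q) (hasDerivAt_id _) h i
  refine (h2.comp t h1).congr_deriv ?_
  rw [← h.profileDeriv_rate hΩ]
  fin_cases i <;>
    simp [profileDeriv, posDeriv, momDeriv, ampDeriv, denomDeriv, rateDeriv, radicandDeriv] <;>
    ring

theorem pOrbit_eq (h : Exterior ζ q) (τ : ℝ) : pOrbit ζ q τ = momProfile ζ q (phase ζ q τ) := by
  have h1 : HasDerivAt (fun s => qOrbit ζ q s)
      (posDeriv q 0 (phase ζ q τ) (Real.sqrt (radicand ζ q (phase ζ q τ)))) τ :=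
    hasDerivAt_posProfile (hasDerivAt_const _ q) (h.hasDerivAt_phase τ)
  have h2 : qOrbit ζ q τ = posProfile q (phase ζ q τ) := rfl
  rw [pOrbit, h1.deriv, posDeriv_rate, h2, mul_div_cancel_left₀]
  positivity

theorem chi_eq (h : Exterior ζ q) {Ω : ℝ} (hΩ : 0 < Ω) (t : ℝ) :
    chi Ω ζ q t = profile Ω ζ q (phase ζ q (Ω * t)) := by
  have hα : alpha Ω ζ q t = Real.sqrt (Ω / 2) * posProfile q (phase ζ q (Ω * t)) := rfl
  have hβ : beta Ω ζ q t = Real.sqrt (Ω / 2) * momProfile ζ q (phase ζ q (Ω * t)) := by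
    rw [beta, h.pOrbit_eq]
  have hA : amp Ω ζ q t = Real.sqrt (Ω / 2) * ampProfile ζ q (phase ζ q (Ω * t)) := by
    have h1 : 0 ≤ Real.sqrt (Ω / 2) * ampProfile ζ q (phase ζ q (Ω * t)) :=
      mul_nonneg (Real.sqrt_nonneg _) (mul_nonneg (Real.sqrt_nonneg _) (denom_pos _ _).le)
    rw [amp, hα, hβ, power, mul_pow, mul_pow, Real.sq_sqrt (by positivity : 0 ≤ Ω / 2),
      ← Real.sqrt_sq h1, mul_pow, Real.sq_sqrt (by positivity : 0 ≤ Ω / 2), ← h.profile_power]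
    congr 1
    ring
  rw [chi, hα, hβ, hA, profile]

theorem hasDerivAt_chi (h : Exterior ζ q) {Ω : ℝ} (hΩ : 0 < Ω) (t : ℝ) (i : Fin 3) :
    HasDerivAt (fun t => chi Ω ζ q t i) (field Ω i (chi Ω ζ q t)) t := by
  simp only [h.chi_eq hΩ]
  exact h.hasDerivAt_profile_phase hΩ t i

end Exterior

theorem hasDerivAt_chi_family {zf qf : ℝ → ℝ} {x₀ Ω : ℝ} (hΩ : 0 < Ω) (hz : ContDiff ℝ 2 zf)
    (hq : ContDiff ℝ 2 qf) (h : Exterior (zf x₀) (qf x₀)) (t : ℝ) (i : Fin 3) :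
    HasDerivAt (fun x => chi Ω (zf x) (qf x) t i)
      (profileDeriv Ω (zf x₀) (qf x₀) (deriv zf x₀) (deriv qf x₀)
        (phase (zf x₀) (qf x₀) (Ω * t))
        (phaseDeriv (zf x₀) (qf x₀) (deriv zf x₀) (deriv qf x₀)
          (phase (zf x₀) (qf x₀) (Ω * t))) i) x₀ := by
  have h1 := hasDerivAt_profile Ω (hz.differentiable (by norm_num) x₀).hasDerivAt
    (hq.differentiable (by norm_num) x₀).hasDerivAt (hasDerivAt_phase_family hz hq h (Ω * t)) h i
  refine h1.congr_of_eventuallyEq ?_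
  filter_upwards [eventually_exterior hz.continuous.continuousAt hq.continuous.continuousAt h]
    with x hx
  rw [hx.chi_eq hΩ]

/-! ### The variational equation. -/

section Variation

variable {zf qf : ℝ → ℝ} {x₀ : ℝ}

theorem contDiffAt_radicand (hz : ContDiff ℝ 2 zf) (hq : ContDiff ℝ 2 qf) (z : ℝ × ℝ) :
    ContDiffAt ℝ 2 (fun z : ℝ × ℝ => radicand (zf z.1) (qf z.1) z.2) z := by
  unfold radicand
  fun_prop

theorem contDiffAt_rate (hz : ContDiff ℝ 2 zf) (hq : ContDiff ℝ 2 qf) (h : Exterior (zf x₀) (qf x₀))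
    (y : ℝ) :
    ContDiffAt ℝ 2 (fun z : ℝ × ℝ => Real.sqrt (radicand (zf z.1) (qf z.1) z.2)) (x₀, y) :=
  (contDiffAt_radicand hz hq _).sqrt (h.radicand_pos y).ne'

theorem contDiffAt_denom (hq : ContDiff ℝ 2 qf) (z : ℝ × ℝ) :
    ContDiffAt ℝ 2 (fun z : ℝ × ℝ => denom (qf z.1) z.2) z := by
  unfold denom
  refine ContDiffAt.sqrt (by fun_prop) ?_
  positivity

theorem contDiffAt_profile (Ω : ℝ) (hz : ContDiff ℝ 2 zf) (hq : ContDiff ℝ 2 qf)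
    (h : Exterior (zf x₀) (qf x₀)) (y : ℝ) (i : Fin 3) :
    ContDiffAt ℝ 2 (fun z : ℝ × ℝ => profile Ω (zf z.1) (qf z.1) z.2 i) (x₀, y) := by
  have hD := contDiffAt_denom hq (x₀, y)
  have hD0 := (denom_pos (qf x₀) y).ne'
  have hR := contDiffAt_rate hz hq h y
  have hA : ContDiffAt ℝ 2 (fun z : ℝ × ℝ => Real.sqrt (1 + zf z.1 - qf z.1 ^ 2)) (x₀, y) :=
    ContDiffAt.sqrt (by fun_prop) (sub_pos.2 h.sq_lt).ne'
  fin_cases i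
  · exact contDiffAt_const.mul (ContDiffAt.div (by fun_prop) hD hD0)
  · exact contDiffAt_const.mul (((ContDiffAt.mul (by fun_prop) hR).div hD hD0).neg)
  · exact contDiffAt_const.mul (hA.mul hD)

/-- Restriction to a line through the base point identifies the abstract derivative with the closed
formula. -/
theorem fderiv_profile (Ω : ℝ) (hz : ContDiff ℝ 2 zf) (hq : ContDiff ℝ 2 qf)
    (h : Exterior (zf x₀) (qf x₀)) (y a b : ℝ) (i : Fin 3) :
    fderiv ℝ (fun z : ℝ × ℝ => profile Ω (zf z.1) (qf z.1) z.2 i) (x₀, y) (a, b) =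
      profileDeriv Ω (zf x₀) (qf x₀) (a * deriv zf x₀) (a * deriv qf x₀) y b i := by
  have hd := ((contDiffAt_profile Ω hz hq h y i).differentiableAt (by norm_num)).hasFDerivAt
  have h1 : HasDerivAt (fun s : ℝ => x₀ + s * a) a 0 := by
    simpa using ((hasDerivAt_id (0 : ℝ)).mul_const a).const_add x₀
  have h2 : HasDerivAt (fun s : ℝ => y + s * b) b 0 := by
    simpa using ((hasDerivAt_id (0 : ℝ)).mul_const b).const_add y
  have e1 : HasDerivAt (fun s : ℝ => profile Ω (zf (x₀ + s * a)) (qf (x₀ + s * a)) (y + s * b) i)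
      (fderiv ℝ (fun z : ℝ × ℝ => profile Ω (zf z.1) (qf z.1) z.2 i) (x₀, y) (a, b)) 0 :=
    hd.comp_hasDerivAt_of_eq 0 (h1.prodMk h2) (by simp)
  have hzd : HasDerivAt (fun s : ℝ => zf (x₀ + s * a)) (a * deriv zf x₀) 0 :=
    ((hz.differentiable (by norm_num) x₀).hasDerivAt.comp_of_eq 0 h1 (by simp)).congr_deriv
      (mul_comm _ _)
  have hqd : HasDerivAt (fun s : ℝ => qf (x₀ + s * a)) (a * deriv qf x₀) 0 :=
    ((hq.differentiable (by norm_num) x₀).hasDerivAt.comp_of_eq 0 h1 (by simp)).congr_deriv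
      (mul_comm _ _)
  have e2 := hasDerivAt_profile Ω hzd hqd h2 (by simpa using h) i
  have := e1.unique e2
  simpa using this

theorem fderiv_rate (hz : ContDiff ℝ 2 zf) (hq : ContDiff ℝ 2 qf)
    (h : Exterior (zf x₀) (qf x₀)) (y b : ℝ) :
    fderiv ℝ (fun z : ℝ × ℝ => Real.sqrt (radicand (zf z.1) (qf z.1) z.2)) (x₀, y) (1, b) =
      rateDeriv (zf x₀) (qf x₀) (deriv zf x₀) (deriv qf x₀) y b := by
  have hd := ((contDiffAt_rate hz hq h y).differentiableAt (by norm_num)).hasFDerivAt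
  have h2 : HasDerivAt (fun x : ℝ => y + (x - x₀) * b) b x₀ := by
    simpa using (((hasDerivAt_id x₀).sub_const x₀).mul_const b).const_add y
  have e1 : HasDerivAt (fun x : ℝ => Real.sqrt (radicand (zf x) (qf x) (y + (x - x₀) * b)))
      (fderiv ℝ (fun z : ℝ × ℝ => Real.sqrt (radicand (zf z.1) (qf z.1) z.2)) (x₀, y) (1, b)) x₀ :=
    hd.comp_hasDerivAt_of_eq x₀ ((hasDerivAt_id x₀).prodMk h2) (by simp)
  have e2 := hasDerivAt_rate (hz.differentiable (by norm_num) x₀).hasDerivAt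
    (hq.differentiable (by norm_num) x₀).hasDerivAt h2 h
  have := e1.unique e2
  simpa using this

/-- The angle's own variational equation. `phaseDeriv` is rate times integral: differentiating the
rate gives the homogeneous term, and differentiating the integral gives the forcing by the
parameters. -/
theorem Exterior.hasDerivAt_phaseDeriv {ζ q : ℝ} (h : Exterior ζ q) (ζ' q' : ℝ) {φ : ℝ → ℝ}
    {t Ω : ℝ} (hφ : HasDerivAt φ (Ω * Real.sqrt (radicand ζ q (φ t))) t) :
    HasDerivAt (fun t => phaseDeriv ζ q ζ' q' (φ t))
      (Ω * rateDeriv ζ q ζ' q' (φ t) (phaseDeriv ζ q ζ' q' (φ t))) t := by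
  have hR := h.rate_pos (φ t)
  have h1 := hasDerivAt_rate (hasDerivAt_const t ζ) (hasDerivAt_const t q) hφ h
  have hc : Continuous fun s => radicandDeriv ζ q ζ' q' s / (2 * Real.sqrt (radicand ζ q s) ^ 3) := by
    refine Continuous.div (by unfold radicandDeriv; fun_prop) (by unfold radicand; fun_prop)
      fun s => ?_
    have := h.rate_pos s
    positivity
  have h2 := (hc.integral_hasStrictDerivAt 0 (φ t)).hasDerivAt.comp t hφ
  refine (h1.mul h2).congr_deriv ?_
  simp only [rateDeriv, phaseDeriv, Function.comp_apply]
  generalize (∫ s in (0 : ℝ)..φ t,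
    radicandDeriv ζ q ζ' q' s / (2 * Real.sqrt (radicand ζ q s) ^ 3)) = I
  simp only [radicandDeriv]
  field_simp
  ring

theorem hasDerivAt_profileDeriv {Ω : ℝ} (hΩ : 0 < Ω) (hz : ContDiff ℝ 2 zf)
    (hq : ContDiff ℝ 2 qf) (h : Exterior (zf x₀) (qf x₀)) {v : ℝ → Fin 3 → ℝ}
    (hv : ∀ t, v t = profileDeriv Ω (zf x₀) (qf x₀) (deriv zf x₀) (deriv qf x₀)
        (phase (zf x₀) (qf x₀) (Ω * t))
        (phaseDeriv (zf x₀) (qf x₀) (deriv zf x₀) (deriv qf x₀)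
          (phase (zf x₀) (qf x₀) (Ω * t)))) (t : ℝ) (i : Fin 3) :
    HasDerivAt (fun t => v t i)
      (∑ j, jacobian Ω (chi Ω (zf x₀) (qf x₀) t) i j * v t j) t := by
  have hφ : HasDerivAt (fun t => phase (zf x₀) (qf x₀) (Ω * t))
      (Ω * Real.sqrt (radicand (zf x₀) (qf x₀) (phase (zf x₀) (qf x₀) (Ω * t)))) t := by
    have := (h.hasDerivAt_phase (Ω * t)).comp t ((hasDerivAt_id t).const_mul Ω)
    refine this.congr_deriv (by ring)
  have hrd := (contDiffAt_rate hz hq h (phase (zf x₀) (qf x₀) (Ω * t))).differentiableAt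
    (by norm_num)
  have hψ := h.hasDerivAt_phaseDeriv (deriv zf x₀) (deriv qf x₀) hφ
  have hev : ∀ᶠ z : ℝ × ℝ in 𝓝 (x₀, phase (zf x₀) (qf x₀) (Ω * t)),
      Exterior (zf z.1) (qf z.1) :=
    continuousAt_fst.eventually
      (eventually_exterior hz.continuous.continuousAt hq.continuous.continuousAt h)
  have key := hasDerivAt_variation
    (X := fun i z => profile Ω (zf z.1) (qf z.1) z.2 i)
    (r := fun z => Ω * Real.sqrt (radicand (zf z.1) (qf z.1) z.2)) (V := field Ω)
    (φ := fun t => phase (zf x₀) (qf x₀) (Ω * t))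
    (ψ := fun t => phaseDeriv (zf x₀) (qf x₀) (deriv zf x₀) (deriv qf x₀)
          (phase (zf x₀) (qf x₀) (Ω * t)))
    (fun i => contDiffAt_profile Ω hz hq h _ i) (hrd.const_mul Ω)
    (fun i => (hasFDerivAt_field Ω i _).differentiableAt) hφ
    (by
      rw [fderiv_const_mul hrd, _root_.smul_apply, fderiv_rate hz hq h]
      exact hψ)
    (fun i => hev.mono fun z hzx => by
      have e := fderiv_profile Ω hz hq hzx z.2 0 1 i
      have e' := hzx.profileDeriv_rate hΩ z.2 i
      simp only [zero_mul, Prod.mk.eta] at e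
      rw [e, ← e']
      fin_cases i <;>
        simp [profileDeriv, posDeriv, momDeriv, ampDeriv, denomDeriv, rateDeriv, radicandDeriv] <;>
        ring) i
  rw [(hasFDerivAt_field Ω i _).fderiv] at key
  simp only [fderiv_profile Ω hz hq h, one_mul] at key
  simp only [hv, h.chi_eq hΩ]
  refine key.congr_deriv ?_
  simp

end Variation

end DoubleWell

/-! ### The fundamental matrix. -/

namespace DoubleWell

namespace Exterior

variable {Ω ζ q : ℝ}

theorem chiDeriv_zero (h : Exterior ζ q) (hΩ : 0 < Ω) (t : ℝ) (i : Fin 3) :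
    chiDeriv Ω ζ q t i 0 = profileDeriv Ω ζ q 0 1 (phase ζ q (Ω * t))
      (phaseDeriv ζ q 0 1 (phase ζ q (Ω * t))) i := by
  have := (hasDerivAt_chi_family (zf := fun _ => ζ) (qf := fun x => x) hΩ contDiff_const contDiff_id
    h t i).deriv
  simpa [chiDeriv] using this

theorem chiDeriv_one (h : Exterior ζ q) (hΩ : 0 < Ω) (t : ℝ) (i : Fin 3) :
    chiDeriv Ω ζ q t i 1 = field Ω i (chi Ω ζ q t) := by
  simpa [chiDeriv] using (h.hasDerivAt_chi hΩ t i).deriv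

theorem chiDeriv_two (h : Exterior ζ q) (hΩ : 0 < Ω) (t : ℝ) (i : Fin 3) :
    chiDeriv Ω ζ q t i 2 = profileDeriv Ω ζ q 1 0 (phase ζ q (Ω * t))
      (phaseDeriv ζ q 1 0 (phase ζ q (Ω * t))) i := by
  have := (hasDerivAt_chi_family (zf := fun z => z) (qf := fun _ => q) hΩ contDiff_id contDiff_const
    h t i).deriv
  simpa [chiDeriv] using this

theorem hasDerivAt_chiDeriv (h : Exterior ζ q) (hΩ : 0 < Ω) (t : ℝ) (i j : Fin 3) :
    HasDerivAt (fun t => chiDeriv Ω ζ q t i j)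
      ((jacobian Ω (chi Ω ζ q t) * chiDeriv Ω ζ q t) i j) t := by
  rw [Matrix.mul_apply]
  fin_cases j
  · exact hasDerivAt_profileDeriv (zf := fun _ => ζ) (qf := fun x => x) (x₀ := q)
      (v := fun t i => chiDeriv Ω ζ q t i 0) hΩ contDiff_const contDiff_id h
      (fun t => by ext i; simpa using h.chiDeriv_zero hΩ t i) t i
  · have h1 : HasDerivAt (fun t => chi Ω ζ q t) (fun i => field Ω i (chi Ω ζ q t)) t :=
      hasDerivAt_pi.2 fun i => h.hasDerivAt_chi hΩ t i
    have h2 := (hasFDerivAt_field Ω i (chi Ω ζ q t)).comp_hasDerivAt t h1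
    have e : (fun t => chiDeriv Ω ζ q t i 1) = field Ω i ∘ fun t => chi Ω ζ q t :=
      funext fun t => h.chiDeriv_one hΩ t i
    change HasDerivAt (fun t => chiDeriv Ω ζ q t i 1)
      (∑ j, jacobian Ω (chi Ω ζ q t) i j * chiDeriv Ω ζ q t j 1) t
    rw [e]
    refine h2.congr_deriv ?_
    simp [h.chiDeriv_one hΩ]
  · exact hasDerivAt_profileDeriv (zf := fun z => z) (qf := fun _ => q) (x₀ := ζ)
      (v := fun t i => chiDeriv Ω ζ q t i 2) hΩ contDiff_id contDiff_const h
      (fun t => by ext i; simpa using h.chiDeriv_two hΩ t i) t i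

/-- At time zero the angle is 0 for all parameters, so only the explicit parameter dependence
survives. -/
theorem chiDeriv_zero_time (h : Exterior ζ q) (hΩ : 0 < Ω) :
    chiDeriv Ω ζ q 0 = !![Real.sqrt (Ω / 2), 0, 0;
      0, -(Ω * (2 * q ^ 2 - ζ) * Real.sqrt (Ω / 2) * q), 0;
      -(Real.sqrt (Ω / 2) * q / Real.sqrt (1 + ζ - q ^ 2)), 0,
        Real.sqrt (Ω / 2) / (2 * Real.sqrt (1 + ζ - q ^ 2))] := by
  have hp : phase ζ q (Ω * 0) = 0 := by rw [mul_zero, h.phase_zero]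
  have hψ : ∀ ζ' q', phaseDeriv ζ q ζ' q' 0 = 0 := fun _ _ => by simp [phaseDeriv]
  have hA := h.amp_zero_pos
  have hA2 := h.amp_zero_sq
  have hS : Real.sqrt (Ω / 2) ^ 2 = Ω / 2 := Real.sq_sqrt (by positivity)
  ext i j
  fin_cases j
  · change chiDeriv Ω ζ q 0 i 0 = _
    rw [h.chiDeriv_zero hΩ, hp, hψ, profileDeriv]
    generalize Real.sqrt (Ω / 2) = S
    fin_cases i <;> simp [posDeriv, momDeriv, ampDeriv, denomDeriv]
    field_simp
  · change chiDeriv Ω ζ q 0 i 1 = _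
    rw [h.chiDeriv_one hΩ, h.chi_eq hΩ, hp, profile]
    simp only [posProfile, momProfile, ampProfile]
    generalize Real.sqrt (Ω / 2) = S at *
    generalize Real.sqrt (1 + ζ - q ^ 2) = A at *
    fin_cases i <;> simp [field]
    linear_combination (2 * A ^ 2 - 2 * q ^ 2) * S * q * hS + Ω * S * q * hA2
  · change chiDeriv Ω ζ q 0 i 2 = _
    rw [h.chiDeriv_two hΩ, hp, hψ, profileDeriv]
    generalize Real.sqrt (Ω / 2) = S
    fin_cases i <;> simp [posDeriv, momDeriv, ampDeriv, denomDeriv]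
    field_simp

/-- The right factor that turns `chiDeriv` into the fundamental matrix. -/
noncomputable def normalizer (Ω ζ q : ℝ) : Matrix (Fin 3) (Fin 3) ℝ :=
  !![1 / Real.sqrt (Ω / 2), 0, 0;
    0, -(1 / (Ω * (2 * q ^ 2 - ζ) * Real.sqrt (Ω / 2) * q)), 0;
    2 * q / Real.sqrt (Ω / 2), 0, 2 * Real.sqrt (1 + ζ - q ^ 2) / Real.sqrt (Ω / 2)]

theorem Mtilde_zero_time (h : Exterior ζ q) (hΩ : 0 < Ω) :
    Mtilde Ω ζ q 0 = !![1, 0, 0; 0, 1, 0; -(q / Real.sqrt (1 + ζ - q ^ 2)), 0, 1] := by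
  have hS : 0 < Real.sqrt (Ω / 2) := Real.sqrt_pos.2 (by positivity)
  have hA := h.amp_zero_pos
  have hq := h.pos
  have hW := h.freqSq_pos
  ext i j
  simp only [Mtilde, h.chiDeriv_zero_time hΩ]
  generalize Real.sqrt (Ω / 2) = S at *
  generalize 2 * q ^ 2 - ζ = W at *
  fin_cases i <;> fin_cases j <;> simp [hΩ.ne', hS.ne', hA.ne', hq.ne', hW.ne']
  field_simp

theorem M_zero_time (h : Exterior ζ q) (hΩ : 0 < Ω) : M Ω ζ q 0 = 1 := by
  refine Matrix.mul_nonsing_inv _ ?_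
  rw [h.Mtilde_zero_time hΩ, Matrix.det_fin_three]
  simp

/-- The first column of the factor is the direction `(ζ', q') = (2q, 1)`, which leaves `1 + ζ - q²`,
hence `A(0)`, fixed. -/
theorem M_eq (h : Exterior ζ q) (hΩ : 0 < Ω) (t : ℝ) :
    M Ω ζ q t = chiDeriv Ω ζ q t * normalizer Ω ζ q := by
  have hS : 0 < Real.sqrt (Ω / 2) := Real.sqrt_pos.2 (by positivity)
  have hA := h.amp_zero_pos
  have hinv : (Mtilde Ω ζ q 0)⁻¹ =
      !![1, 0, 0; 0, 1, 0; q / Real.sqrt (1 + ζ - q ^ 2), 0, 1] := by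
    refine Matrix.inv_eq_right_inv ?_
    rw [h.Mtilde_zero_time hΩ]
    ext i j
    fin_cases i <;> fin_cases j <;> simp [Matrix.mul_apply, Fin.sum_univ_three]
  rw [M, hinv]
  ext i j
  simp only [Matrix.mul_apply, Fin.sum_univ_three, Mtilde, Matrix.of_apply,
    h.chiDeriv_zero_time hΩ, normalizer]
  generalize Real.sqrt (Ω / 2) = S at *
  fin_cases j <;> simp <;> field_simp

theorem hasDerivAt_M (h : Exterior ζ q) (hΩ : 0 < Ω) (t : ℝ) (i j : Fin 3) :
    HasDerivAt (fun s => M Ω ζ q s i j) ((jacobian Ω (chi Ω ζ q t) * M Ω ζ q t) i j) t := by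
  simp only [h.M_eq hΩ, ← Matrix.mul_assoc]
  rw [Matrix.mul_apply]
  simp only [Matrix.mul_apply (M := chiDeriv _ _ _ _)]
  exact HasDerivAt.fun_sum fun k _ => (h.hasDerivAt_chiDeriv hΩ t i k).mul_const _

end Exterior

end DoubleWell

/-! ### Elementary norm and absolute value bounds. -/

theorem norm_toEuclideanCLM_le {A : Matrix (Fin 3) (Fin 3) ℝ} {B : ℝ} (hA : ∀ i j, |A i j| ≤ B) :
    ‖Matrix.toEuclideanCLM (n := Fin 3) (𝕜 := ℝ) A‖ ≤ 9 * B := by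
  have hB : 0 ≤ B := (abs_nonneg _).trans (hA 0 0)
  refine ContinuousLinearMap.opNorm_le_bound _ (by positivity) fun x => ?_
  have hx : ∀ j, |x j| ≤ ‖x‖ := fun j => PiLp.norm_apply_le x j
  have hi : ∀ i, |Matrix.toEuclideanCLM (n := Fin 3) (𝕜 := ℝ) A x i| ≤ 3 * B * ‖x‖ := by
    intro i
    have e : Matrix.toEuclideanCLM (n := Fin 3) (𝕜 := ℝ) A x i = ∑ j, A i j * x j := rfl
    rw [e]
    refine (Finset.abs_sum_le_sum_abs _ _).trans ?_
    refine (Finset.sum_le_sum (g := fun _ => B * ‖x‖) fun j _ => ?_).trans (by simp [mul_assoc])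
    rw [abs_mul]
    exact mul_le_mul (hA i j) (hx j) (abs_nonneg _) hB
  rw [EuclideanSpace.norm_eq]
  refine Real.sqrt_le_iff.2 ⟨by positivity, ?_⟩
  refine (Finset.sum_le_sum (g := fun _ => (3 * B * ‖x‖) ^ 2) fun i _ => ?_).trans ?_
  · rw [Real.norm_eq_abs]
    exact pow_le_pow_left₀ (abs_nonneg _) (hi i) 2
  · simp
    nlinarith [sq_nonneg (B * ‖x‖)]

theorem abs_div_le_of_one_le {a b d : ℝ} (hd : 1 ≤ d) (h : |a| ≤ b) : |a / d| ≤ b := by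
  rw [abs_div, abs_of_pos (zero_lt_one.trans_le hd)]
  exact (div_le_self (abs_nonneg a) hd).trans h

theorem abs_mul_le_of_abs_le_one {a b s : ℝ} (hs : |s| ≤ 1) (h : |a| ≤ b) : |a * s| ≤ b := by
  rw [abs_mul]
  exact (mul_le_of_le_one_right (abs_nonneg a) hs).trans h

theorem abs_mul_le {a b A B : ℝ} (ha : |a| ≤ A) (hb : |b| ≤ B) : |a * b| ≤ A * B := by
  rw [abs_mul]
  exact mul_le_mul ha hb (abs_nonneg b) ((abs_nonneg a).trans ha)

theorem abs_sin_sq_le_one (y : ℝ) : |Real.sin y ^ 2| ≤ 1 := by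
  rw [abs_of_nonneg (sq_nonneg _)]
  exact Real.sin_sq_le_one y

/-! ### Size of the parameter derivatives in powers of `q`. -/

namespace DoubleWell

/-- Parameters of an orbit bounded away from the separatrix, with sizes controlled by `K`. -/
structure BoundedExterior (K ζ q : ℝ) : Prop extends Exterior ζ q where
  one_le : 1 ≤ K
  zeta_pos : 0 < ζ
  three_le : 3 * ζ / 2 ≤ q ^ 2
  sq_le : q ^ 2 ≤ K
  zeta_le : 1 + ζ ≤ K

namespace BoundedExterior

variable {K ζ q : ℝ}

theorem le (h : BoundedExterior K ζ q) : q ≤ K := by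
  nlinarith [h.sq_le, h.one_le, h.pos]

theorem one_le_div (h : BoundedExterior K ζ q) : 1 ≤ K / q := by
  rw [le_div_iff₀ h.pos, one_mul]
  exact h.le

/-- Bounded terms are absorbed into multiples of `1/q`, since `q ≤ K`. -/
theorem le_div {a c : ℝ} (h : BoundedExterior K ζ q) (hc : 0 ≤ c) (ha : a ≤ c) : a ≤ c * K / q := by
  rw [mul_div_assoc]
  exact ha.trans (le_mul_of_one_le_right hc h.one_le_div)

theorem denom_le (h : BoundedExterior K ζ q) (y : ℝ) : denom q y ≤ 1 + K := by
  refine Real.sqrt_le_iff.2 ⟨by linarith [h.one_le], ?_⟩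
  nlinarith [mul_le_mul_of_nonneg_left (Real.sin_sq_le_one y) (sq_nonneg q), h.sq_le, h.one_le]

/-- From `ζ ≤ 2q²/3` one gets `q² - ζ ≥ q²/3`, which exceeds `(q/2)²`. -/
theorem le_rate (h : BoundedExterior K ζ q) (y : ℝ) :
    q / 2 ≤ Real.sqrt (radicand ζ q y) := by
  refine Real.le_sqrt_of_sq_le (le_trans ?_ (h.radicand_ge y))
  nlinarith [h.three_le, mul_nonneg (sub_pos.2 h.lt_sq).le (sq_nonneg q)]

theorem rate_le (h : BoundedExterior K ζ q) (y : ℝ) : Real.sqrt (radicand ζ q y) ≤ 2 * q := by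
  refine Real.sqrt_le_iff.2 ⟨by linarith [h.pos], (h.radicand_le y).trans ?_⟩
  nlinarith [h.zeta_pos, sq_nonneg q]

theorem abs_rate_le (h : BoundedExterior K ζ q) (y : ℝ) :
    |Real.sqrt (radicand ζ q y)| ≤ 2 * q := by
  rw [abs_of_nonneg (Real.sqrt_nonneg _)]
  exact h.rate_le y

theorem abs_amp_zero_le (h : BoundedExterior K ζ q) : |Real.sqrt (1 + ζ - q ^ 2)| ≤ K := by
  rw [abs_of_nonneg (Real.sqrt_nonneg _)]
  refine Real.sqrt_le_iff.2 ⟨by linarith [h.one_le], ?_⟩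
  nlinarith [h.one_le, h.zeta_le, sq_nonneg q]

theorem modulus_sq_le (h : BoundedExterior K ζ q) : modulus ζ q ^ 2 ≤ 3 / 4 := by
  rw [h.modulus_sq, div_le_iff₀ h.freqSq_pos]
  nlinarith [h.three_le, mul_nonneg (sub_nonneg.2 h.three_le) (sq_nonneg q),
    mul_pos h.zeta_pos (pow_pos h.pos 2)]

theorem le_freq (h : BoundedExterior K ζ q) : q ≤ freq ζ q :=
  Real.le_sqrt_of_sq_le (by linarith [h.lt_sq])

theorem freq_le (h : BoundedExterior K ζ q) : freq ζ q ≤ 2 * q := by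
  refine Real.sqrt_le_iff.2 ⟨by linarith [h.pos], ?_⟩
  nlinarith [h.zeta_pos, sq_nonneg q]

/-- The rate contributes `2q`, the integrand `E / (2(q/2)³)` and the interval `4π`. -/
theorem abs_phaseDeriv_le (h : BoundedExterior K ζ q) {ζ' q' E y : ℝ}
    (hE : ∀ s, |radicandDeriv ζ q ζ' q' s| ≤ E) (hy : |y| ≤ 4 * Real.pi) :
    |phaseDeriv ζ q ζ' q' y| ≤ 32 * Real.pi * E / q ^ 2 := by
  have hq := h.pos
  have hE0 : 0 ≤ E := (abs_nonneg _).trans (hE 0)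
  have h1 : ‖∫ s in (0 : ℝ)..y, radicandDeriv ζ q ζ' q' s / (2 * Real.sqrt (radicand ζ q s) ^ 3)‖ ≤
      E / (2 * (q / 2) ^ 3) * |y - 0| := by
    refine intervalIntegral.norm_integral_le_of_norm_le_const fun s _ => ?_
    have hR := h.rate_pos s
    rw [Real.norm_eq_abs, abs_div, abs_of_pos (by positivity : 0 < 2 * Real.sqrt (radicand ζ q s) ^ 3)]
    have := h.le_rate s
    gcongr
    exact hE s
  rw [sub_zero, Real.norm_eq_abs] at h1
  refine (abs_mul_le (h.abs_rate_le y) h1).trans ?_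
  calc 2 * q * (E / (2 * (q / 2) ^ 3) * |y|)
      ≤ 2 * q * (E / (2 * (q / 2) ^ 3) * (4 * Real.pi)) := by gcongr
    _ = 32 * Real.pi * E / q ^ 2 := by field_simp; ring

/-- The angle enters with a factor `q²`, which compensates the `q⁻²` growth of its variation. -/
theorem abs_denomDeriv_le (h : BoundedExterior K ζ q) {q' y y' P : ℝ} (hq' : |q'| ≤ 1)
    (hy' : |y'| ≤ P / q ^ 2) : |denomDeriv q q' y y'| ≤ K + P := by
  have hq := h.pos
  have hqa : |q| ≤ K := by rw [abs_of_pos hq]; exact h.le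
  refine abs_div_le_of_one_le (one_le_denom q y) ((abs_add_le _ _).trans (add_le_add ?_ ?_))
  · exact abs_mul_le_of_abs_le_one (abs_sin_sq_le_one y) (abs_mul_le_of_abs_le_one hq' hqa)
  · have h1 : |q ^ 2 * Real.sin y * Real.cos y| ≤ q ^ 2 :=
      abs_mul_le_of_abs_le_one (Real.abs_cos_le_one y)
        (abs_mul_le_of_abs_le_one (Real.abs_sin_le_one y) (abs_of_nonneg (sq_nonneg q)).le)
    refine (abs_mul_le h1 hy').trans_eq ?_
    field_simp

theorem abs_rateDeriv_le (h : BoundedExterior K ζ q) {ζ' q' y y' P E : ℝ}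
    (hE : |radicandDeriv ζ q ζ' q' y| ≤ E) (hy' : |y'| ≤ P / q ^ 2) :
    |rateDeriv ζ q ζ' q' y y'| ≤ (E + 2 * K * P) / q := by
  have hq := h.pos
  have hR := h.rate_pos y
  have hE0 : 0 ≤ E := (abs_nonneg _).trans hE
  have hA : |2 * ((1 + ζ - q ^ 2) * q ^ 2) * Real.sin y * Real.cos y| ≤ 2 * (K * q ^ 2) := by
    refine abs_mul_le_of_abs_le_one (Real.abs_cos_le_one y)
      (abs_mul_le_of_abs_le_one (Real.abs_sin_le_one y) ?_)
    have h0 := sub_pos.2 h.sq_lt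
    rw [abs_of_nonneg (by positivity)]
    have : 1 + ζ - q ^ 2 ≤ K := by linarith [h.zeta_le, sq_nonneg q]
    gcongr
  have hN : |radicandDeriv ζ q ζ' q' y -
      2 * ((1 + ζ - q ^ 2) * q ^ 2) * Real.sin y * Real.cos y * y'| ≤ E + 2 * K * P := by
    refine (abs_sub _ _).trans (add_le_add hE ((abs_mul_le hA hy').trans_eq ?_))
    field_simp
  have hN0 : 0 ≤ E + 2 * K * P := (abs_nonneg _).trans hN
  rw [rateDeriv, abs_div, abs_of_pos (by positivity : 0 < 2 * Real.sqrt (radicand ζ q y))]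
  have := h.le_rate y
  exact div_le_div₀ hN0 hN hq (by linarith)

/-- The term `q sin y · y'` has only one factor `q` against `q⁻²`; this is where `1/q` arises. -/
theorem abs_posDeriv_le (h : BoundedExterior K ζ q) {q' y y' P : ℝ} (hq' : |q'| ≤ 1)
    (hP : 0 ≤ P) (hy' : |y'| ≤ P / q ^ 2) :
    |posDeriv q q' y y'| ≤ (P + K + K * (K + P) * K) / q := by
  have hq := h.pos
  have hK := h.one_le
  have hD := one_le_denom q y
  have hqs : ∀ {s : ℝ}, |s| ≤ 1 → |q * s| ≤ q := fun hs =>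
    abs_mul_le_of_abs_le_one hs (abs_of_pos hq).le
  have h1 : |(q' * Real.cos y - q * Real.sin y * y') / denom q y| ≤ K / q + P / q := by
    refine abs_div_le_of_one_le hD ((abs_sub _ _).trans (add_le_add ?_ ?_))
    · exact (abs_mul_le_of_abs_le_one (Real.abs_cos_le_one y) hq').trans h.one_le_div
    · refine (abs_mul_le (hqs (Real.abs_sin_le_one y)) hy').trans_eq ?_
      field_simp
  have h2 : |q * Real.cos y * denomDeriv q q' y y' / denom q y ^ 2| ≤ K * (K + P) * K / q := by
    refine abs_div_le_of_one_le (one_le_pow₀ hD) (h.le_div (by positivity) ?_)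
    exact abs_mul_le ((hqs (Real.abs_cos_le_one y)).trans h.le) (h.abs_denomDeriv_le hq' hy')
  refine (abs_sub _ _).trans ((add_le_add h1 h2).trans_eq ?_)
  ring

/-- The rate is itself `O(q)`, so every term is bounded and `1/q` is only a common form. -/
theorem abs_momDeriv_le (h : BoundedExterior K ζ q) {ζ' q' y y' P E : ℝ} (hq' : |q'| ≤ 1)
    (hP : 0 ≤ P) (hE : |radicandDeriv ζ q ζ' q' y| ≤ E) (hy' : |y'| ≤ P / q ^ 2) :
    |momDeriv ζ q ζ' q' y y'| ≤
      (2 * K + 2 * P + (E + 2 * K * P) + 2 * K * K * (K + P)) * K / q := by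
  have hq := h.pos
  have hK := h.one_le
  have hE0 : 0 ≤ E := (abs_nonneg _).trans hE
  have hD := one_le_denom q y
  have hqs : ∀ {s : ℝ}, |s| ≤ 1 → |q * s| ≤ q := fun hs =>
    abs_mul_le_of_abs_le_one hs (abs_of_pos hq).le
  refine h.le_div (by positivity) ?_
  rw [momDeriv, abs_neg]
  refine (abs_sub _ _).trans (add_le_add ((abs_add_le _ _).trans (add_le_add ?_ ?_)) ?_)
  · refine abs_div_le_of_one_le hD ?_
    have h1 : |q' * Real.sin y + q * Real.cos y * y'| ≤ 1 + q * (P / q ^ 2) :=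
      (abs_add_le _ _).trans (add_le_add
        (abs_mul_le_of_abs_le_one (Real.abs_sin_le_one y) hq')
        (abs_mul_le (hqs (Real.abs_cos_le_one y)) hy'))
    refine (abs_mul_le h1 (h.abs_rate_le y)).trans ?_
    have : (1 + q * (P / q ^ 2)) * (2 * q) = 2 * q + 2 * P := by field_simp
    rw [this]
    linarith [h.le]
  · refine abs_div_le_of_one_le hD ?_
    refine (abs_mul_le (hqs (Real.abs_sin_le_one y)) (h.abs_rateDeriv_le hE hy')).trans_eq ?_
    field_simp
  · refine abs_div_le_of_one_le (one_le_pow₀ hD) ?_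
    refine (abs_mul_le (abs_mul_le (hqs (Real.abs_sin_le_one y)) (h.abs_rate_le y))
      (h.abs_denomDeriv_le hq' hy')).trans ?_
    have := h.le
    have e : 2 * K * K * (K + P) = K * (2 * K) * (K + P) := by ring
    rw [e]
    gcongr

theorem abs_radicandDeriv_zeta_le (h : BoundedExterior K ζ q) (s : ℝ) :
    |radicandDeriv ζ q 1 0 s| ≤ 8 * K * K := by
  have h1 := h.sq_le
  have h2 := h.one_le
  have h3 : q ^ 2 * Real.sin s ^ 2 ≤ q ^ 2 :=
    mul_le_of_le_one_right (sq_nonneg q) (Real.sin_sq_le_one s)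
  have h4 : 0 ≤ q ^ 2 * Real.sin s ^ 2 := by positivity
  have e : radicandDeriv ζ q 1 0 s = -(1 + q ^ 2 * Real.sin s ^ 2) := by
    unfold radicandDeriv; ring
  rw [e, abs_neg, abs_of_pos (by linarith)]
  nlinarith

theorem abs_radicandDeriv_pos_le (h : BoundedExterior K ζ q) (s : ℝ) :
    |radicandDeriv ζ q 0 1 s| ≤ 8 * K * K := by
  have hq := h.pos
  have h1 := h.sq_le
  have h2 := h.one_le
  have h3 := h.le
  have hz := h.zeta_pos
  have hz' := h.zeta_le
  have e : radicandDeriv ζ q 0 1 s = 4 * q - 2 * q * (1 + ζ - 2 * q ^ 2) * Real.sin s ^ 2 := by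
    unfold radicandDeriv; ring
  have h4 : |1 + ζ - 2 * q ^ 2| ≤ 2 * K := by
    rw [abs_le]; constructor <;> nlinarith [sq_nonneg q]
  have h5 : |2 * q * (1 + ζ - 2 * q ^ 2) * Real.sin s ^ 2| ≤ 2 * K * (2 * K) := by
    refine abs_mul_le_of_abs_le_one (abs_sin_sq_le_one s) (abs_mul_le ?_ h4)
    rw [abs_of_pos (by positivity)]
    linarith
  have h6 : |4 * q| ≤ 4 * K * K := by
    rw [abs_of_pos (by positivity)]
    nlinarith
  rw [e]
  refine (abs_sub _ _).trans ((add_le_add h6 h5).trans_eq ?_)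
  ring

theorem abs_posProfile_le (h : BoundedExterior K ζ q) (y : ℝ) : |posProfile q y| ≤ q :=
  abs_div_le_of_one_le (one_le_denom q y)
    (abs_mul_le_of_abs_le_one (Real.abs_cos_le_one y) (abs_of_pos h.pos).le)

theorem abs_momProfile_le (h : BoundedExterior K ζ q) (y : ℝ) :
    |momProfile ζ q y| ≤ q * (2 * q) := by
  rw [momProfile, abs_neg]
  exact abs_div_le_of_one_le (one_le_denom q y)
    (abs_mul_le (abs_mul_le_of_abs_le_one (Real.abs_sin_le_one y) (abs_of_pos h.pos).le)
      (h.abs_rate_le y))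

theorem abs_ampProfile_le (h : BoundedExterior K ζ q) (y : ℝ) :
    |ampProfile ζ q y| ≤ K * (1 + K) := by
  refine abs_mul_le h.abs_amp_zero_le ?_
  rw [abs_of_pos (denom_pos q y)]
  exact h.denom_le y

end BoundedExterior

end DoubleWell

/-! ### Bounds on the entries of the fundamental matrix. -/

namespace DoubleWell

/-- A bound for the variation of the position with the parameters, times `q`. -/
def posBound (K P : ℝ) : ℝ := P + K + K * (K + P) * K

/-- A bound for the variation of the momentum with the parameters, times `q`. -/
def momBound (K P : ℝ) : ℝ :=
  (2 * K + 2 * P + (8 * K * K + 2 * K * P) + 2 * K * K * (K + P)) * K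

namespace Exterior

variable {Ω ζ q : ℝ}

theorem M_apply_zero (h : Exterior ζ q) (hΩ : 0 < Ω) (t : ℝ) (i : Fin 3) :
    M Ω ζ q t i 0 =
      (chiDeriv Ω ζ q t i 0 + 2 * q * chiDeriv Ω ζ q t i 2) / Real.sqrt (Ω / 2) := by
  rw [h.M_eq hΩ, Matrix.mul_apply, Fin.sum_univ_three]
  generalize chiDeriv Ω ζ q t = X
  unfold normalizer
  generalize Real.sqrt (Ω / 2) = S
  simp
  ring

theorem M_apply_one (h : Exterior ζ q) (hΩ : 0 < Ω) (t : ℝ) (i : Fin 3) :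
    M Ω ζ q t i 1 =
      -(chiDeriv Ω ζ q t i 1 / (Ω * (2 * q ^ 2 - ζ) * Real.sqrt (Ω / 2) * q)) := by
  rw [h.M_eq hΩ, Matrix.mul_apply, Fin.sum_univ_three]
  generalize chiDeriv Ω ζ q t = X
  unfold normalizer
  generalize Ω * (2 * q ^ 2 - ζ) * Real.sqrt (Ω / 2) * q = S
  simp
  ring

theorem M_apply_two (h : Exterior ζ q) (hΩ : 0 < Ω) (t : ℝ) (i : Fin 3) :
    M Ω ζ q t i 2 =
      2 * Real.sqrt (1 + ζ - q ^ 2) * chiDeriv Ω ζ q t i 2 / Real.sqrt (Ω / 2) := by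
  rw [h.M_eq hΩ, Matrix.mul_apply, Fin.sum_univ_three]
  generalize chiDeriv Ω ζ q t = X
  unfold normalizer
  generalize Real.sqrt (Ω / 2) = S
  simp
  ring

end Exterior

namespace BoundedExterior

variable {K Ω ζ q : ℝ}

theorem abs_M_zero_le (h : BoundedExterior K ζ q) (hΩ : 0 < Ω) {P : ℝ}
    (hP : P = 32 * Real.pi * (8 * K * K)) {t : ℝ}
    (ht : |phase ζ q (Ω * t)| ≤ 4 * Real.pi) (i : Fin 3) :
    |M Ω ζ q t i 0| ≤ (1 + 2 * K) * (posBound K P + momBound K P + K * (K + P) * K) / q := by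
  have hS : 0 < Real.sqrt (Ω / 2) := Real.sqrt_pos.2 (by positivity)
  have hK := h.one_le
  have hq := h.pos
  have hP0 : 0 ≤ P := by rw [hP]; positivity
  have hψ1 := h.abs_phaseDeriv_le h.abs_radicandDeriv_pos_le ht
  have hψ2 := h.abs_phaseDeriv_le h.abs_radicandDeriv_zeta_le ht
  rw [← hP] at hψ1 hψ2
  have hq1 : |(1 : ℝ)| ≤ 1 := by simp
  have hq0 : |(0 : ℝ)| ≤ 1 := by simp
  have h2q : |2 * q| ≤ 2 * K := by rw [abs_of_pos (by positivity)]; linarith [h.le]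
  have hpb : 0 ≤ posBound K P := by unfold posBound; positivity
  have hmb : 0 ≤ momBound K P := by unfold momBound; positivity
  have hdb : 0 ≤ K * (K + P) * K := by positivity
  rw [h.M_apply_zero hΩ, h.chiDeriv_zero hΩ, h.chiDeriv_two hΩ, mul_div_assoc]
  have step : ∀ {a b c : ℝ}, 0 ≤ c → |a| ≤ c / q → |b| ≤ c / q →
      c ≤ posBound K P + momBound K P + K * (K + P) * K →
      |a + 2 * q * b| ≤ (1 + 2 * K) * ((posBound K P + momBound K P + K * (K + P) * K) / q) := by
    intro a b c hc ha hb hcle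
    refine (abs_add_le _ _).trans ((add_le_add ha (abs_mul_le h2q hb)).trans ?_)
    have : c / q ≤ (posBound K P + momBound K P + K * (K + P) * K) / q := by gcongr
    nlinarith
  fin_cases i
  · have := step hpb (h.abs_posDeriv_le (y := phase ζ q (Ω * t)) hq1 hP0 hψ1)
      (h.abs_posDeriv_le (y := phase ζ q (Ω * t)) hq0 hP0 hψ2) (by linarith)
    refine le_of_eq_of_le ?_ this
    congr 1
    simp only [profileDeriv, Fin.zero_eta, Matrix.cons_val_zero]
    field_simp
  · have := step hmb (h.abs_momDeriv_le (y := phase ζ q (Ω * t)) hq1 hP0 (h.abs_radicandDeriv_pos_le _) hψ1)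
      (h.abs_momDeriv_le (y := phase ζ q (Ω * t)) hq0 hP0 (h.abs_radicandDeriv_zeta_le _) hψ2) (by linarith)
    refine le_of_eq_of_le ?_ this
    congr 1
    simp only [profileDeriv, Fin.mk_one, Matrix.cons_val_one, Matrix.cons_val_zero]
    field_simp
  · have hA := h.amp_zero_pos
    -- In the combination `∂_{q₀} + 2q ∂_ζ` the terms with `1/√(1 + ζ - q²)` cancel, so only the
    -- `denomDeriv` terms need bounds.
    have h1 := h.le_div (by positivity)
      (abs_mul_le h.abs_amp_zero_le (h.abs_denomDeriv_le (y := phase ζ q (Ω * t)) hq1 hψ1))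
    have h2 := h.le_div (by positivity)
      (abs_mul_le h.abs_amp_zero_le (h.abs_denomDeriv_le (y := phase ζ q (Ω * t)) hq0 hψ2))
    have := step hdb h1 h2 (by linarith)
    refine le_of_eq_of_le ?_ this
    congr 1
    simp only [profileDeriv, Fin.reduceFinMk, Matrix.cons_val, ampDeriv]
    field_simp
    ring

theorem abs_M_two_le (h : BoundedExterior K ζ q) (hΩ : 0 < Ω) {P : ℝ}
    (hP : P = 32 * Real.pi * (8 * K * K)) {t : ℝ}
    (ht : |phase ζ q (Ω * t)| ≤ 4 * Real.pi) (i : Fin 3) :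
    |M Ω ζ q t i 2| ≤
      (2 * K * posBound K P + 2 * K * momBound K P +
        (1 + K + 2 * ((K + K) * (K + P))) * K) / q := by
  have hS : 0 < Real.sqrt (Ω / 2) := Real.sqrt_pos.2 (by positivity)
  have hK := h.one_le
  have hq := h.pos
  have hP0 : 0 ≤ P := by rw [hP]; positivity
  have hψ := h.abs_phaseDeriv_le h.abs_radicandDeriv_zeta_le ht
  rw [← hP] at hψ
  have hq0 : |(0 : ℝ)| ≤ 1 := by simp
  have hA := h.amp_zero_pos
  have h2A : |2 * Real.sqrt (1 + ζ - q ^ 2)| ≤ 2 * K := by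
    rw [abs_mul, abs_two]; linarith [h.abs_amp_zero_le]
  have hpb : 0 ≤ 2 * K * posBound K P := by unfold posBound; positivity
  have hmb : 0 ≤ 2 * K * momBound K P := by unfold momBound; positivity
  have hdb : 0 ≤ (1 + K + 2 * ((K + K) * (K + P))) * K := by positivity
  rw [h.M_apply_two hΩ, h.chiDeriv_two hΩ]
  have step : ∀ {a c : ℝ}, |a| ≤ c / q → c ≤ 2 * K * posBound K P + 2 * K * momBound K P +
        (1 + K + 2 * ((K + K) * (K + P))) * K → |a| ≤ (2 * K * posBound K P + 2 * K * momBound K P +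
        (1 + K + 2 * ((K + K) * (K + P))) * K) / q :=
    fun ha hc => ha.trans (by gcongr)
  fin_cases i
  · have := abs_mul_le h2A (h.abs_posDeriv_le (y := phase ζ q (Ω * t)) hq0 hP0 hψ)
    rw [← mul_div_assoc] at this
    refine le_of_eq_of_le ?_ (step this (by unfold posBound at *; linarith))
    congr 1
    simp only [profileDeriv, Fin.zero_eta, Matrix.cons_val_zero]
    field_simp
  · have := abs_mul_le h2A (h.abs_momDeriv_le (y := phase ζ q (Ω * t)) hq0 hP0 (h.abs_radicandDeriv_zeta_le _) hψ)
    rw [← mul_div_assoc] at this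
    refine le_of_eq_of_le ?_ (step this (by unfold momBound at *; linarith))
    congr 1
    simp only [profileDeriv, Fin.mk_one, Matrix.cons_val_one, Matrix.cons_val_zero]
    field_simp
  · set y := phase ζ q (Ω * t)
    have hAA : |2 * (1 + ζ - q ^ 2)| ≤ 2 * (K + K) := by
      have h0 := sub_pos.2 h.sq_lt
      rw [abs_of_pos (by positivity)]
      linarith [h.zeta_le, sq_nonneg q]
    -- The prefactor `2√(1 + ζ - q²)` of this column clears the small denominator in `ampDeriv`.
    have h1 : |denom q y + 2 * (1 + ζ - q ^ 2) * denomDeriv q 0 y (phaseDeriv ζ q 1 0 y)| ≤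
        1 + K + 2 * ((K + K) * (K + P)) := by
      refine (abs_add_le _ _).trans (add_le_add ?_ ?_)
      · rw [abs_of_pos (denom_pos q y)]
        exact h.denom_le y
      · exact (abs_mul_le hAA (h.abs_denomDeriv_le (y := phase ζ q (Ω * t)) hq0 hψ)).trans_eq (by ring)
    refine le_of_eq_of_le ?_ (step (h.le_div (by positivity) h1) (by linarith))
    congr 1
    simp only [profileDeriv, Fin.reduceFinMk, Matrix.cons_val, ampDeriv]
    have hA2 := h.amp_zero_sq
    generalize Real.sqrt (1 + ζ - q ^ 2) = A at *
    rw [← hA2]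
    field_simp
    ring

theorem abs_M_one_le (h : BoundedExterior K ζ q) (hΩ : 0 < Ω) (t : ℝ) (i : Fin 3) :
    |M Ω ζ q t i 1| ≤ (2 * (1 + K) + (3 + 4 * K) * K + 2 * K * (K * (1 + K))) / q := by
  have hS : 0 < Real.sqrt (Ω / 2) := Real.sqrt_pos.2 (by positivity)
  have hK := h.one_le
  have hq := h.pos
  have hW : q ^ 2 ≤ 2 * q ^ 2 - ζ := by linarith [h.lt_sq]
  have hW0 := h.freqSq_pos
  set y := phase ζ q (Ω * t) with hy
  have hQ := h.abs_posProfile_le y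
  have hP := h.abs_momProfile_le y
  have hA := h.abs_ampProfile_le y
  have hQ2 : posProfile q y ^ 2 ≤ q ^ 2 := by
    rw [← sq_abs]; exact pow_le_pow_left₀ (abs_nonneg _) hQ 2
  have hP2 : momProfile ζ q y ^ 2 ≤ (q * (2 * q)) ^ 2 := by
    rw [← sq_abs]; exact pow_le_pow_left₀ (abs_nonneg _) hP 2
  -- Since `2q² - ζ ≥ q²`, a field component of relative size `q²` suffices.
  have step : ∀ a : ℝ, |a| ≤ (2 * (1 + K) + (3 + 4 * K) * K + 2 * K * (K * (1 + K))) * q ^ 2 →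
      |-(Ω * (Real.sqrt (Ω / 2) * a) / (Ω * (2 * q ^ 2 - ζ) * Real.sqrt (Ω / 2) * q))| ≤
        (2 * (1 + K) + (3 + 4 * K) * K + 2 * K * (K * (1 + K))) / q := by
    intro a ha
    have e : Ω * (Real.sqrt (Ω / 2) * a) / (Ω * (2 * q ^ 2 - ζ) * Real.sqrt (Ω / 2) * q) =
        a / (2 * q ^ 2 - ζ) / q := by field_simp
    rw [abs_neg, e, abs_div, abs_div, abs_of_pos hq, abs_of_pos hW0]
    gcongr
    rw [div_le_iff₀ hW0]
    exact ha.trans (by gcongr)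
  rw [h.M_apply_one hΩ, h.chiDeriv_one hΩ, h.chi_eq hΩ, ← hy, ← h.profileDeriv_rate hΩ,
    profileDeriv, posDeriv_rate, h.momDeriv_rate, h.ampDeriv_rate]
  have hc1 : 0 ≤ 2 * (1 + K) := by positivity
  have hc2 : 0 ≤ (3 + 4 * K) * K := by positivity
  have hc3 : 0 ≤ 2 * K * (K * (1 + K)) := by positivity
  fin_cases i
  · refine step _ ?_
    have h1 : |1 + posProfile q y ^ 2| ≤ 1 + K := by
      rw [abs_of_pos (by positivity)]; linarith [h.sq_le]
    refine (abs_mul_le h1 hP).trans ?_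
    nlinarith [mul_nonneg hc2 (sq_nonneg q), mul_nonneg hc3 (sq_nonneg q)]
  · refine step _ ?_
    have h1 : |1 + posProfile q y ^ 2 - ampProfile ζ q y ^ 2| ≤ (3 + 4 * K) * q ^ 2 := by
      -- Conservation turns the factor, a difference of quantities of order one, into `2Q² + P² -
      -- ζ`, with `Q`, `P` the position and momentum profiles; each term is visibly `O(q²)`.
      rw [← h.profile_power y]
      have h4 : (q * (2 * q)) ^ 2 ≤ 4 * K * q ^ 2 := by nlinarith [h.sq_le, sq_nonneg q]
      have h5 := sq_nonneg (posProfile q y)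
      have h6 := sq_nonneg (momProfile ζ q y)
      have h7 := mul_nonneg (by linarith : (0 : ℝ) ≤ K) (sq_nonneg q)
      rw [abs_le]
      constructor <;> nlinarith [h.lt_sq, h.zeta_pos]
    have h2 := abs_mul_le (a := -(1 + posProfile q y ^ 2 - ampProfile ζ q y ^ 2))
      ((abs_neg _).trans_le h1) (hQ.trans h.le)
    refine h2.trans ?_
    nlinarith [mul_nonneg hc1 (sq_nonneg q), mul_nonneg hc3 (sq_nonneg q)]
  · refine step _ ?_
    rw [abs_neg]
    refine (abs_mul_le (abs_mul_le (hQ.trans h.le) hP) hA).trans ?_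
    nlinarith [mul_nonneg hc1 (sq_nonneg q), mul_nonneg hc2 (sq_nonneg q)]

end BoundedExterior

theorem exists_abs_M_le (K : ℝ) (hK : 1 ≤ K) : ∃ C, 0 < C ∧ ∀ Ω ζ q t : ℝ, 0 < Ω →
    BoundedExterior K ζ q → |phase ζ q (Ω * t)| ≤ 4 * Real.pi →
    ∀ i j, |M Ω ζ q t i j| ≤ C / q := by
  obtain ⟨P, hP⟩ : ∃ P, P = 32 * Real.pi * (8 * K * K) := ⟨_, rfl⟩
  have hP0 : 0 ≤ P := by rw [hP]; positivity
  have hpb : 0 ≤ posBound K P := by unfold posBound; positivity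
  have hmb : 0 ≤ momBound K P := by unfold momBound; positivity
  have h0 : 0 ≤ (1 + 2 * K) * (posBound K P + momBound K P + K * (K + P) * K) := by positivity
  have h1 : 0 < 2 * (1 + K) + (3 + 4 * K) * K + 2 * K * (K * (1 + K)) := by positivity
  have h2 : 0 ≤ 2 * K * posBound K P + 2 * K * momBound K P +
        (1 + K + 2 * ((K + K) * (K + P))) * K := by positivity
  refine ⟨_ + _ + _, add_pos_of_pos_of_nonneg (add_pos_of_nonneg_of_pos h0 h1) h2, ?_⟩
  intro Ω ζ q t hΩ h ht i j
  have hq := h.pos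
  fin_cases j
  · exact (h.abs_M_zero_le hΩ hP ht i).trans (div_le_div_of_nonneg_right (by linarith) hq.le)
  · exact (h.abs_M_one_le hΩ t i).trans (div_le_div_of_nonneg_right (by linarith) hq.le)
  · exact (h.abs_M_two_le hΩ hP ht i).trans (div_le_div_of_nonneg_right (by linarith) hq.le)

/-! ### The period, and the angle during one period. -/

namespace BoundedExterior

variable {K Ω ζ q : ℝ}

theorem period_le (h : BoundedExterior K ζ q) (hΩ : 0 < Ω) :
    period Ω ζ q ≤ 4 * Real.pi / (q * Ω) := by
  have hq := h.pos
  have h1 := ellipticK_le_pi h.modulus_sq_le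
  have h2 := h.le_freq
  unfold period
  gcongr

theorem le_period (h : BoundedExterior K ζ q) (hΩ : 0 < Ω) :
    Real.pi / (q * Ω) ≤ period Ω ζ q := by
  have hq := h.pos
  have hf := h.freq_pos
  have h1 := pi_div_two_le_ellipticK h.modulus_sq_lt_one
  have h2 := h.freq_le
  have e : Real.pi / (q * Ω) = 4 * (Real.pi / 2) / (2 * q * Ω) := by field_simp; norm_num
  have h3 : 0 ≤ ellipticK (modulus ζ q) := le_trans (by positivity) h1
  rw [e]
  unfold period
  gcongr

/-- The angle is at most `ωΩt < 4K(k) ≤ 4π`. -/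
theorem abs_phase_le_of_lt_period (h : BoundedExterior K ζ q) (hΩ : 0 < Ω) {t : ℝ} (ht : 0 < t)
    (htT : t < period Ω ζ q) : |phase ζ q (Ω * t)| ≤ 4 * Real.pi := by
  have hf := h.freq_pos
  refine (h.abs_phase_le _).trans ?_
  rw [abs_of_pos (by positivity)]
  rw [period, lt_div_iff₀ (by positivity)] at htT
  have h1 := ellipticK_le_pi h.modulus_sq_le
  nlinarith

end BoundedExterior

end DoubleWell

/-! ### Translation into powers of `σ`. -/

theorem lemma4p2 (γ : ℝ) (hγ : 7 / 9 < γ) (hγ' : γ < 1) (c₁ c₂ : ℝ) (hc₁ : 0 < c₁)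
    (hc₂ : 0 < c₂) :
    ∃ C σ₀ : ℝ, 0 < C ∧ 0 < σ₀ ∧
      ∀ σ Ω ζ q₀ : ℝ, 0 < σ → σ < σ₀ →
        c₁ * σ ^ γ ≤ Ω → Ω ≤ c₂ * σ ^ γ →
        0 < ζ → ζ ≤ c₂ * σ ^ (1 - γ) →
        Real.sqrt (3 * ζ / 2) ≤ q₀ → c₁ * σ ^ ((1 - γ) / 2) ≤ q₀ → q₀ ^ 2 < 1 + ζ →
        -- `M` is the fundamental matrix of the linearization about the orbit
        (DoubleWell.M Ω ζ q₀ 0 = 1 ∧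
          ∀ (t : ℝ) (i j : Fin 3), HasDerivAt (fun s : ℝ => DoubleWell.M Ω ζ q₀ s i j)
            ((DoubleWell.jacobian Ω (DoubleWell.chi Ω ζ q₀ t) * DoubleWell.M Ω ζ q₀ t) i j) t) ∧
        -- the size of the period
        DoubleWell.period Ω ζ q₀ ≤ C * σ ^ (-(1 + γ) / 2) ∧
        (q₀ ≤ c₂ * σ ^ ((1 - γ) / 2) →
          σ ^ (-(1 + γ) / 2) ≤ C * DoubleWell.period Ω ζ q₀) ∧
        -- the bound, in the Euclidean operator norm, within one period
        ∀ t : ℝ, 0 < t → t < DoubleWell.period Ω ζ q₀ →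
          ‖Matrix.toEuclideanCLM (n := Fin 3) (𝕜 := ℝ) (DoubleWell.M Ω ζ q₀ t)‖ ≤
            C * σ ^ ((γ - 1) / 2) := by
  -- For `σ < 1` one has `ζ ≤ c₂`, hence `q² < 1 + ζ ≤ 1 + c₂`.
  obtain ⟨C, hC, hM⟩ := DoubleWell.exists_abs_M_le (1 + c₂) (by linarith)
  have hpi := Real.pi_pos
  -- One summand for each estimate: upper period bound, lower period bound, norm of `M`.
  refine ⟨4 * Real.pi / (c₁ * c₁) + c₂ * c₂ / Real.pi + 9 * (C / c₁), 1, by positivity, one_pos, ?_⟩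
  intro σ Ω ζ q hσ hσ1 hΩ₁ hΩ₂ hζ hζ₂ hqζ hq hqlt
  have hσγ : 0 < σ ^ γ := Real.rpow_pos_of_pos hσ _
  have hσm : 0 < σ ^ ((1 - γ) / 2) := Real.rpow_pos_of_pos hσ _
  have hΩ : 0 < Ω := lt_of_lt_of_le (by positivity) hΩ₁
  have hq0 : 0 < q := lt_of_lt_of_le (by positivity) hq
  have hζc : ζ ≤ c₂ := hζ₂.trans
    (mul_le_of_le_one_right hc₂.le (Real.rpow_le_one hσ.le hσ1.le (by linarith)))
  have h3 : 3 * ζ / 2 ≤ q ^ 2 := (Real.sqrt_le_left hq0.le).1 hqζ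
  have h : DoubleWell.BoundedExterior (1 + c₂) ζ q :=
    { pos := hq0, lt_sq := by linarith, sq_lt := hqlt, one_le := by linarith, zeta_pos := hζ
      three_le := h3, sq_le := by linarith, zeta_le := by linarith }
  -- The product `qΩ` scales as `σ^((1+γ)/2)`, the reciprocal of the claimed size of the period.
  have hprod : σ ^ ((1 - γ) / 2) * σ ^ γ = (σ ^ (-(1 + γ) / 2))⁻¹ := by
    rw [← Real.rpow_neg hσ.le, ← Real.rpow_add hσ]
    congr 1
    ring
  have hτ : 0 < σ ^ (-(1 + γ) / 2) := Real.rpow_pos_of_pos hσ _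
  have hinv : σ ^ ((γ - 1) / 2) = (σ ^ ((1 - γ) / 2))⁻¹ := by
    rw [← Real.rpow_neg hσ.le]
    congr 1
    ring
  refine ⟨⟨h.M_zero_time hΩ, h.hasDerivAt_M hΩ⟩, ?_, fun hq₂ => ?_, fun t ht htT => ?_⟩
  · have h1 : c₁ * c₁ * (σ ^ (-(1 + γ) / 2))⁻¹ ≤ q * Ω := by
      rw [← hprod]
      calc c₁ * c₁ * (σ ^ ((1 - γ) / 2) * σ ^ γ) = c₁ * σ ^ ((1 - γ) / 2) * (c₁ * σ ^ γ) := by ring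
        _ ≤ q * Ω := by gcongr
    calc DoubleWell.period Ω ζ q ≤ 4 * Real.pi / (q * Ω) := h.period_le hΩ
      _ ≤ 4 * Real.pi / (c₁ * c₁ * (σ ^ (-(1 + γ) / 2))⁻¹) := by gcongr
      _ = 4 * Real.pi / (c₁ * c₁) * σ ^ (-(1 + γ) / 2) := by field_simp
      _ ≤ _ := by
        gcongr
        rw [add_assoc]
        exact le_add_of_nonneg_right (by positivity)
  · have h1 : q * Ω ≤ c₂ * c₂ * (σ ^ (-(1 + γ) / 2))⁻¹ := by
      rw [← hprod]
      calc q * Ω ≤ c₂ * σ ^ ((1 - γ) / 2) * (c₂ * σ ^ γ) := by gcongr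
        _ = c₂ * c₂ * (σ ^ ((1 - γ) / 2) * σ ^ γ) := by ring
    have h2 := h.le_period hΩ
    have hT : 0 ≤ DoubleWell.period Ω ζ q := le_trans (by positivity) h2
    calc σ ^ (-(1 + γ) / 2)
        = c₂ * c₂ / Real.pi * (Real.pi / (c₂ * c₂ * (σ ^ (-(1 + γ) / 2))⁻¹)) := by field_simp
      _ ≤ c₂ * c₂ / Real.pi * (Real.pi / (q * Ω)) := by gcongr
      _ ≤ c₂ * c₂ / Real.pi * DoubleWell.period Ω ζ q := by gcongr
      _ ≤ _ := by
        gcongr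
        rw [add_right_comm]
        exact le_add_of_nonneg_left (by positivity)
  · have h1 := norm_toEuclideanCLM_le
      (hM Ω ζ q t hΩ h (h.abs_phase_le_of_lt_period hΩ ht htT))
    calc _ ≤ 9 * (C / q) := h1
      _ ≤ 9 * (C / (c₁ * σ ^ ((1 - γ) / 2))) := by gcongr
      _ = 9 * (C / c₁) * σ ^ ((γ - 1) / 2) := by rw [hinv]; field_simp
      _ ≤ _ := by
        gcongr
        exact le_add_of_nonneg_left (by positivity)
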